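/- **Setting.** A generalized link with two arc components $L=(L_1,L_2)$, $L_i:[0,1]\to\mathbb R^3$, is a pair of disjoint continuous arcs, each endpoint $x$ being constrained to an affine subspace $M_x$, and both arcs being constrained to the region where finitely many $C^1$ functions $g_k$, having $0$ as a regular value, are nonnegative. Its Gehring thickness $\mathrm{Thi}(L)$ is the minimal distance between points of $L_1$ and $L_2$, and $O(L)=\min_k\min_{x\in L}g_k(x)$. A continuous vector field $\xi$ along $L$ is compatible if it is tangent to $M_x$ at each endpoint $x$. A rectifiable curve $L_i$ has finite total curvature if its first variation of length is $\delta_\xi\mathrm{Len}(L_i)=-\int\langle\xi,d\mathcal K_i\rangle$ for a vector-valued Radon measure $\mathcal K_i$ along it; the right-hand side then defines $\delta_\xi\mathrm{Len}(L_i)$ for all continuous $\xi$. For weights $w_i$ put $\delta_\xi\mathrm{Len}^w=\sum_i w_i\,\delta_\xi\mathrm{Len}(L_i)$. $L$ is strongly critical for weighted Gehring ropelength if its components have finite total curvature and there is $\varepsilon>0$ such that, for every compatible $\xi$ with $\delta_\xi\mathrm{Len}^w=-1$, the one-sided derivatives $\delta^+_\xi\mathrm{Thi}$ and $\delta^+_\xi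 O$ of $\mathrm{Thi}(L+r\xi)$ and $O(L+r\xi)$ at $r=0^+$ exist and satisfy $\min(\delta^+_\xi\mathrm{Thi},\delta^+_\xi O)\le-\varepsilon$. **The weighted clasp $C(\tau_1,\tau_2)$.** Let $\tau_1,\tau_2\in(0,1]$. Use coordinates $(x_1,x_2,z)$ on $\mathbb R^3$ with unit vectors $e_1,e_2,e_z$, put $\sigma_1=1$, $\sigma_2=-1$ and $n_i^\pm=\pm\sqrt{1-\tau_i^2}\,e_i+\sigma_i\tau_i e_z$. For $c_1,c_2\in\mathbb R$, the endpoints of the $i$th arc are constrained to the planes $\{\langle n_i^\pm,p\rangle=c_i\}$ (at angle $\arcsin\tau_i$ to the vertical), and both arcs have to stay in the region $\langle n_i^\pm,p\rangle\le c_i$ ($i=1,2$). The isotopy class is that of two hooks: polygonal arcs $(-a_i,k_i),(0,h_i),(a_i,k_i)$ in the $x_iz$-planes, $a_i>0$, with $h_1<h_2$ and both tips in the interior of the region. **The configuration.** For $0\le u\le\tau_i$ and $j\ne i$ let $u_j=\tau_j(1-u/\tau_i)$, so that $u/\tau_i+u_j/\tau_j=1$, and let $$x_i(u)=\sqrt{\frac{u^2(1-u_j^2)}{1-u^2u_j^2}},\qquad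 \zeta_i(u)=\int_0^u\frac{s}{\sqrt{1-s^2}}\,x_i'(s)\,ds ,$$ extended to $-\tau_i\le u\le\tau_i$ with $x_i$ odd and $\zeta_i$ even. Let $t_1=0$, $t_2=\sqrt{1-\tau_2^2}+\zeta_2(\tau_2)$, and $\alpha_i(u)=x_i(u)e_i+(t_i+\sigma_i\zeta_i(u))e_z$. Suppose $\langle n_i^+,\alpha_i(\tau_i)\rangle<c_i$ for $i=1,2$ (the planes leave room for the curved arcs), and extend both ends of each $\alpha_i$ by straight segments in the directions $n_i^\pm$ up to the bounding planes. **Theorem.** This pair of arcs is a generalized link for the constraints above and lies in the isotopy class of the clasp. Points $\alpha_1(u_1)$, $\alpha_2(u_2)$ with $|u_1|/\tau_1+|u_2|/\tau_2=1$ are at distance $1$, the Gehring thickness is $1$, and the configuration is strongly critical for weighted Gehring ropelength with weights $w_i=1/\tau_i$. -/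

import Mathlib

open scoped unitInterval

noncomputable section

namespace Clasp

/-- Euclidean three-space, with coordinates `(x₁, x₂, z)` indexed by `0, 1, 2`. -/
abbrev E3 := EuclideanSpace ℝ (Fin 3)

/-! ### Generalized links whose components are arcs -/

/-- The constraints of a generalized link all of whose components (indexed by `ι`) are arcs:
an affine subspace for each endpoint (`false` for the initial and `true` for the final one),
and obstacles `{p | g p < 0}` indexed by `κ`. -/
structure Constraints (ι κ : Type) where
  endpoint : ι → Bool → AffineSubspace ℝ E3
  obstacle : κ → E3 → ℝ

variable {ι κ : Type}

/-- `L` is a generalized link for the constraints `C`: the obstacle functions are `C¹` with `0`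
as a regular value, and `L` consists of disjoint arcs that obey the constraints. -/
structure IsGeneralizedLink (C : Constraints ι κ) (L : ι → I → E3) : Prop where
  obstacle_contDiff : ∀ k, ContDiff ℝ 1 (C.obstacle k)
  obstacle_regular : ∀ k p, C.obstacle k p = 0 → fderiv ℝ (C.obstacle k) p ≠ 0
  continuous : ∀ i, Continuous (L i)
  disjoint : ∀ i j, i ≠ j → ∀ s t, L i s ≠ L j t
  start_mem : ∀ i, L i 0 ∈ C.endpoint i false
  end_mem : ∀ i, L i 1 ∈ C.endpoint i true
  avoids : ∀ k i t, 0 ≤ C.obstacle k (L i t)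

/-- An isotopy between two generalized links with the same constraints: a continuous family of
generalized links whose components are embedded arcs. -/
def Isotopic (C : Constraints ι κ) (L L' : ι → I → E3) : Prop :=
  ∃ H : I → ι → I → E3,
    (∀ i, Continuous fun q : I × I => H q.1 i q.2) ∧ H 0 = L ∧ H 1 = L' ∧
    ∀ r, IsGeneralizedLink C (H r) ∧ ∀ i, Function.Injective (H r i)

/-- The Gehring thickness: the minimal distance between points on different components. -/
def gThi (L : ι → I → E3) : ℝ :=
  sInf {d | ∃ i j, i ≠ j ∧ ∃ s t, d = dist (L i s) (L j t)}

/-- The obstacle function `O(L)`, the minimum of all obstacle functions over the link. -/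
def obstacleMin (C : Constraints ι κ) (L : ι → I → E3) : ℝ :=
  ⨅ q : κ × ι × I, C.obstacle q.1 (L q.2.1 q.2.2)

/-- The link obtained by moving `L` along the vector field `ξ` for time `r`. -/
def vary (L : ι → I → E3) (ξ : ι → C(I, E3)) (r : ℝ) : ι → I → E3 :=
  fun i t => L i t + r • ξ i t

/-- `d` is the one-sided first variation of the functional `Φ` at `L` in the direction `ξ`. -/
def HasOneSidedVariation (Φ : (ι → I → E3) → ℝ) (L : ι → I → E3) (ξ : ι → C(I, E3))
    (d : ℝ) : Prop :=
  HasDerivWithinAt (fun r => Φ (vary L ξ r)) d (Set.Ici 0) 0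

/-- A continuous vector field along a link is compatible if it is tangent to the constraining
affine subspaces at the endpoints. -/
def Compatible (C : Constraints ι κ) (ξ : ι → C(I, E3)) : Prop :=
  ∀ i, ξ i 0 ∈ (C.endpoint i false).direction ∧ ξ i 1 ∈ (C.endpoint i true).direction

/-- The length of a curve. -/
def len (γ : I → E3) : ℝ := (eVariationOn γ Set.univ).toReal

/-- The rectifiable curve `γ` has finite total curvature, with curvature force `K`: a
vector-valued Radon measure along `γ`, that is, a continuous linear functional on continuous
vector fields, such that the first variation of length along every `C¹` vector field `ξ` is
`-K ξ`. (`K` includes the atoms at the two endpoints. As `C¹` fields are dense, `K` is unique.) -/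
def IsCurvatureForce (γ : I → E3) (K : C(I, E3) →L[ℝ] ℝ) : Prop :=
  eVariationOn γ Set.univ ≠ ⊤ ∧
  ∀ (ξ : C(I, E3)) (f : ℝ → E3), ContDiff ℝ 1 f → (∀ t : I, ξ t = f t) →
    HasDerivAt (fun r : ℝ => len (fun t => γ t + r • ξ t)) (-(K ξ)) 0

/-- Strong criticality for minimizing weighted length (with weights `w`) when constrained by
Gehring thickness: the components have finite total curvature, and for some `ε > 0`, every
compatible continuous `ξ` with first variation of weighted length `-1` decreases the thickness
or the obstacle function to first order at rate at least `ε`. -/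
def StronglyCritical [Fintype ι] (C : Constraints ι κ) (w : ι → ℝ) (L : ι → I → E3) : Prop :=
  ∃ K : ι → C(I, E3) →L[ℝ] ℝ, (∀ i, IsCurvatureForce (L i) (K i)) ∧
    ∃ ε : ℝ, 0 < ε ∧ ∀ ξ : ι → C(I, E3), Compatible C ξ →
      ∑ i, w i * -(K i (ξ i)) = -1 →
      ∃ dT dO : ℝ, HasOneSidedVariation gThi L ξ dT ∧
        HasOneSidedVariation (obstacleMin C) L ξ dO ∧ min dT dO ≤ -ε

/-! ### The weighted clasp problem `C(τ₁, τ₂)`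

Component `0` is attached to the two upper planes and component `1` to the two lower ones. -/

/-- The point with coordinates `(x, z)` in the `xᵢz`-plane. -/
def planePoint (i : Fin 2) (x z : ℝ) : E3 :=
  EuclideanSpace.single i.castSucc x + EuclideanSpace.single 2 z

/-- `+1` for the component going up from its tip, `-1` for the one going down. -/
def updown (i : Fin 2) : ℝ := if i = 0 then 1 else -1

/-- The outward unit normal (at angle `arcsin τᵢ` to the horizontal) of the plane that
constrains the initial (`false`) or final (`true`) endpoint of component `i`. -/
def normal (τ : Fin 2 → ℝ) (i : Fin 2) (b : Bool) : E3 :=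
  planePoint i ((if b then 1 else -1) * √(1 - τ i ^ 2)) (updown i * τ i)

/-- The constraints of `C(τ₁, τ₂)`: the planes `{p | ⟨n, p⟩ = cᵢ}` at signed distance `cᵢ` from
the origin; the complement of the region which they bound is the obstacle. -/
def claspConstraints (τ c : Fin 2 → ℝ) : Constraints (Fin 2) (Fin 2 × Bool) where
  endpoint i b := AffineSubspace.mk' (c i • normal τ i b) (ℝ ∙ normal τ i b)ᗮ
  obstacle k p := c k.1 - inner ℝ (normal τ k.1 k.2) p

/-- The polygonal arc in the `xᵢz`-plane with vertices `(-a, k)`, `(0, h)`, `(a, k)`. -/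
def hookArc (a h k : ℝ) (i : Fin 2) (t : I) : E3 :=
  planePoint i ((2 * (t : ℝ) - 1) * a) (h + |2 * (t : ℝ) - 1| * (k - h))

/-- The isotopy class of the clasp, through its simplest representatives: two hooked polygonal
arcs in perpendicular planes, the tip of the upper arc lying below the tip of the lower arc and
both tips lying inside the tetrahedron. (So if each arc is closed within the planes of its
endpoints, the two closed curves cross the `z`-axis alternately and form a Hopf link.) -/
def InClaspClass (τ c : Fin 2 → ℝ) (L : Fin 2 → I → E3) : Prop :=
  ∃ a h k : Fin 2 → ℝ, (∀ i, 0 < a i) ∧ h 0 < h 1 ∧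
    (∀ i j b, inner ℝ (normal τ j b) (planePoint i 0 (h i)) < c j) ∧
    Isotopic (claspConstraints τ c) L (fun i => hookArc (a i) (h i) (k i) i)

/-! ### The explicit configuration -/

/-- The modulus `uⱼ` of the parameter on the other arc which is paired with `uᵢ = u` by the
balance relation `|u₁| / τ₁ + |u₂| / τ₂ = 1`. -/
def partner (τ : Fin 2 → ℝ) (i : Fin 2) (u : ℝ) : ℝ := τ i.rev * (1 - |u| / τ i)

/-- The coordinate `xᵢ` at parameter `uᵢ = u`, extended as an odd function. -/
def claspX (τ : Fin 2 → ℝ) (i : Fin 2) (u : ℝ) : ℝ :=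
  u * √((1 - partner τ i u ^ 2) / (1 - u ^ 2 * partner τ i u ^ 2))

/-- The height of the point with parameter `u` over the tip (below the tip for the second
component), from `dz / dxᵢ = uᵢ / √(1 - uᵢ²)`. -/
def claspRise (τ : Fin 2 → ℝ) (i : Fin 2) (u : ℝ) : ℝ :=
  ∫ s in (0 : ℝ)..|u|, s / √(1 - s ^ 2) * deriv (claspX τ i) s

/-- The `z`-coordinate of the tip: `0` for the first component. The tip of the second component
is placed so that the strut from the first tip (`u₁ = 0`, hence `u₂ = τ₂ = x₂`) has length `1`. -/
def tipHeight (τ : Fin 2 → ℝ) (i : Fin 2) : ℝ :=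
  if i = 0 then 0 else √(1 - τ 1 ^ 2) + claspRise τ 1 (τ 1)

/-- The `i`th clasp curve. For `|s| ≤ τᵢ` the parameter `s` is `uᵢ`; outside this interval the
curve continues straight, parametrized by arclength. -/
def arcPoint (τ : Fin 2 → ℝ) (i : Fin 2) (s : ℝ) : E3 :=
  let u := max (-τ i) (min (τ i) s)
  planePoint i (claspX τ i u + (s - u) * √(1 - τ i ^ 2))
    (tipHeight τ i + updown i * (claspRise τ i u + (|s| - |u|) * τ i))

/-- The level, in the direction of the normal of its plane, at which the curved part of the
`i`th arc ends. -/
def bendLevel (τ : Fin 2 → ℝ) (i : Fin 2) : ℝ :=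
  inner ℝ (normal τ i true) (arcPoint τ i (τ i))

/-- The configuration of `C(τ₁, τ₂)`: the clasp curves, cut off at the bounding planes, so with
straight ends of length `cᵢ - bendLevel τ i`. -/
def claspConfig (τ c : Fin 2 → ℝ) (i : Fin 2) (t : I) : E3 :=
  arcPoint τ i ((2 * (t : ℝ) - 1) * (τ i + (c i - bendLevel τ i)))

end Clasp

end

open scoped unitInterval
open MeasureTheory intervalIntegral Set Filter Topology Interval

noncomputable section

namespace Clasp

/-! ### Length of curves with integrable derivative, and its first variation. -/

section Variation

variable {E : Type*} [NormedAddCommGroup E] [NormedSpace ℝ E]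

/-! The parameter `u` of an arc is the sine of the angle of its tangent to the horizontal: the unit
tangent is `(√(1 - u²), ± u)` and turns at the rate `(-u / √(1 - u²), ± 1)` per unit of `u`. Put `u
= τ i * p` with `-1 ≤ p ≤ 1`. Then the weight `1 / τ i` cancels the factor `τ i` in `du`, and the
weighted curvature of either arc is its turning vector times `dp`. The balance relation pairs `|p|`
on one arc with `1 - |p|` on the other, so every level `p` in `(0, 1)` carries four struts, joining
the points `± τ 0 * p` of the first arc to the points `± τ 1 * (1 - p)` of the second.

The formula for `xᵢ` solves two requirements on a strut with vertical extent `h`. The two struts at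
a point must add up to a multiple of the turning vector there, `xᵢ √(1 - uᵢ²) = uᵢ h`
(`claspX_mul_sqrt`), and the strut must have unit length, `x₁² + x₂² + h² = 1`
(`Balanced.sq_add_sq_add_sq`). That the heights of the arcs really differ by `h` follows since rise
plus rise plus `h` has zero derivative along balanced pairs
(`Balanced.rise_add_rise_add_strutHeight`). The thickness is 1 because, from a fixed point, the
distance to the other arc decreases up to the strut and increases afterwards
(`one_le_sq_dist_curved`, `straight_le`). The isotopy to the hooks is a straight-line homotopy
within the two perpendicular planes.

For criticality, the endpoint terms of the first variation of length vanish on compatible fields,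
since the arcs meet the planes orthogonally. What remains is the integral over `p` of a density
which, multiplied by `2 h`, is the sum of the length rates of the four struts
(`strutHeight_mul_strutDensity`). The thickness, a minimum of distances, has a right derivative `dT`
that is at most each of these rates, so the density is at least `4 dT / (2 h)`. Integration gives
`-1 ≥ dT * M` with `M = ∫ 2 / h`. The constant `M` is finite even where `h` tends to zero, since `2
/ h` is the density of an actual field, the position field of the configuration. Thus `ε = 1 / M`
works, and of the obstacle function only the existence of its right derivative is needed. -/

theorem intervalIntegrable_of_mem_Icc {F : Type*} [NormedAddCommGroup F] {g : ℝ → F}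
    (hg : IntervalIntegrable g volume 0 1) {s t : ℝ} (hs : s ∈ Icc (0 : ℝ) 1)
    (ht : t ∈ Icc (0 : ℝ) 1) : IntervalIntegrable g volume s t := by
  refine hg.mono_set ?_
  rw [uIcc_of_le zero_le_one]
  exact uIcc_subset_Icc hs ht

/-- The variation of a curve with integrable derivative is at most the integral of its speed. -/
theorem eVariationOn_le_integral_norm {f g : ℝ → E} (hg : IntervalIntegrable g volume 0 1)
    (hf : ∀ s ∈ Icc (0 : ℝ) 1, ∀ t ∈ Icc (0 : ℝ) 1, f t - f s = ∫ x in s..t, g x) :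
    eVariationOn (fun t : I => f t) univ ≤ ENNReal.ofReal (∫ x in (0 : ℝ)..1, ‖g x‖) := by
  set V : I → ℝ := fun t => ∫ x in (0 : ℝ)..t, ‖g x‖ with hV
  have h0 : (0 : ℝ) ∈ Icc (0 : ℝ) 1 := by simp
  have hVsub : ∀ s t : I, V t - V s = ∫ x in (s : ℝ)..t, ‖g x‖ := fun s t =>
    integral_interval_sub_left (intervalIntegrable_of_mem_Icc hg.norm h0 t.2)
      (intervalIntegrable_of_mem_Icc hg.norm h0 s.2)
  have hVmono : Monotone V := fun s t hst => by
    have := hVsub s t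
    have h2 : 0 ≤ ∫ x in (s : ℝ)..t, ‖g x‖ :=
      intervalIntegral.integral_nonneg hst fun _ _ => norm_nonneg _
    linarith
  -- Increments of `f` are dominated by those of the monotone function `V`, whose variation
  -- telescopes to `V 1 - V 0`.
  have h1 : eVariationOn (fun t : I => f t) univ ≤ eVariationOn V univ := by
    refine iSup_mono fun p => Finset.sum_le_sum fun k _ => ?_
    have hk : p.2.1 k ≤ p.2.1 (k + 1) := p.2.2.1 (Nat.le_succ k)
    rw [edist_dist, edist_dist]
    refine ENNReal.ofReal_le_ofReal ?_
    rw [dist_eq_norm, hf _ (p.2.1 k).2 _ (p.2.1 (k + 1)).2, Real.dist_eq, hVsub,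
      abs_of_nonneg (intervalIntegral.integral_nonneg hk fun _ _ => norm_nonneg _)]
    exact norm_integral_le_integral_norm hk
  refine h1.trans ?_
  have h2 : eVariationOn V (univ ∩ Icc 0 1) ≤ ENNReal.ofReal (V 1 - V 0) :=
    ((hVmono.monotoneOn univ).eVariationOn_eq (mem_univ _) (mem_univ _)).le
  have h3 : (univ ∩ Icc (0 : I) 1) = univ := by
    ext x; simp [unitInterval.le_one']
  rw [h3] at h2
  simpa [hV] using h2

end Variation

section Length

variable {E : Type*} [NormedAddCommGroup E] [InnerProductSpace ℝ E]

theorem intervalIntegrable_inner {T g : ℝ → E} {a b : ℝ} (hT : Continuous T)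
    (hg : IntervalIntegrable g volume a b) :
    IntervalIntegrable (fun x => inner ℝ (T x) (g x)) volume a b := by
  have hm := hg.aestronglyMeasurable_restrict_uIoc
  obtain ⟨C, hC⟩ := (isCompact_uIcc (a := a) (b := b)).exists_bound_of_continuousOn
    hT.continuousOn
  rw [intervalIntegrable_iff] at hg ⊢
  refine Integrable.mono' (hg.norm.const_mul C)
    (hT.aestronglyMeasurable.inner hm) ?_
  refine (ae_restrict_iff' measurableSet_uIoc).2 (Eventually.of_forall fun x hx => ?_)
  refine (norm_inner_le_norm _ _).trans ?_
  gcongr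
  exact hC x (uIoc_subset_uIcc hx)

/-- Testing the derivative against a continuous field of vectors of norm at most one gives a
lower bound for the variation. -/
theorem ofReal_integral_inner_le_eVariationOn [CompleteSpace E] {f g T : ℝ → E}
    (hg : IntervalIntegrable g volume 0 1)
    (hf : ∀ s ∈ Icc (0 : ℝ) 1, ∀ t ∈ Icc (0 : ℝ) 1, f t - f s = ∫ x in s..t, g x)
    (hT : Continuous T) (hT1 : ∀ x, ‖T x‖ ≤ 1) :
    ENNReal.ofReal (∫ x in (0 : ℝ)..1, inner ℝ (T x) (g x)) ≤
      eVariationOn (fun t : I => f t) univ := by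
  set J : ℝ := ∫ x in (0 : ℝ)..1, ‖g x‖ with hJ
  have hJ0 : 0 ≤ J := intervalIntegral.integral_nonneg zero_le_one fun _ _ => norm_nonneg _
  refine ENNReal.le_of_forall_pos_le_add fun ε hε _ => ?_
  -- Freezing `T` at the left end of each piece of a fine partition will cost at most this fraction
  -- of `∫ ‖g‖`, hence at most `ε` in total; the `+ 1` covers `J = 0`.
  have hε' : 0 < (ε : ℝ) / (J + 1) := div_pos hε (by linarith)
  have huc : UniformContinuousOn T (Icc (0 : ℝ) 1) :=
    isCompact_Icc.uniformContinuousOn_of_continuous hT.continuousOn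
  obtain ⟨δ, hδ, hTδ⟩ := Metric.uniformContinuousOn_iff.1 huc _ hε'
  obtain ⟨n, hn⟩ := exists_nat_one_div_lt hδ
  set N : ℕ := n + 1 with hN
  have hN0 : (0 : ℝ) < N := by positivity
  -- The partition is capped at 1 so that it is a monotone sequence in the unit interval for all
  -- indices, as `eVariationOn.sum_le` requires.
  let a : ℕ → ℝ := fun k => min ((k : ℝ) / N) 1
  have ha : ∀ k, a k ∈ Icc (0 : ℝ) 1 := fun k => ⟨by positivity, min_le_right _ _⟩
  have hamono : Monotone a := fun k l hkl => by
    refine min_le_min_right _ ?_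
    gcongr
  have hastep : ∀ k, a (k + 1) - a k ≤ 1 / N := fun k => by
    have h : ((k + 1 : ℕ) : ℝ) / N = (k : ℝ) / N + 1 / N := by push_cast; ring
    have h' : (0 : ℝ) ≤ 1 / N := by positivity
    simp only [a, h]
    rcases le_total ((k : ℝ) / N) 1 with h1 | h1
    · rw [min_eq_left h1]; linarith [min_le_left ((k : ℝ) / N + 1 / N) 1]
    · rw [min_eq_right h1]; linarith [min_le_right ((k : ℝ) / N + 1 / N) 1]
  have key : ∀ k, (∫ x in a k..a (k + 1), inner ℝ (T x) (g x)) ≤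
      dist (f (a (k + 1))) (f (a k)) + ε / (J + 1) * ∫ x in a k..a (k + 1), ‖g x‖ := by
    intro k
    have hgk := intervalIntegrable_of_mem_Icc hg (ha k) (ha (k + 1))
    have hle := hamono (Nat.le_succ k)
    have e1 : (∫ x in a k..a (k + 1), inner ℝ (T (a k)) (g x)) ≤
        dist (f (a (k + 1))) (f (a k)) := by
      have e0 : (∫ x in a k..a (k + 1), inner ℝ (T (a k)) (g x)) =
          inner ℝ (T (a k)) (∫ x in a k..a (k + 1), g x) :=
        (innerSL ℝ (T (a k))).intervalIntegral_comp_comm hgk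
      rw [e0, dist_eq_norm, hf _ (ha k) _ (ha (k + 1))]
      refine (real_inner_le_norm _ _).trans ?_
      have := mul_le_mul_of_nonneg_right (hT1 (a k))
        (norm_nonneg (∫ x in a k..a (k + 1), g x))
      linarith
    have e2 : (∫ x in a k..a (k + 1), inner ℝ (T x) (g x)) -
        (∫ x in a k..a (k + 1), inner ℝ (T (a k)) (g x)) ≤
        ∫ x in a k..a (k + 1), ε / (J + 1) * ‖g x‖ := by
      rw [← intervalIntegral.integral_sub (intervalIntegrable_inner hT hgk)
        (intervalIntegrable_inner continuous_const hgk)]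
      refine integral_mono_on hle ((intervalIntegrable_inner hT hgk).sub
        (intervalIntegrable_inner continuous_const hgk)) (hgk.norm.const_mul _) fun x hx => ?_
      rw [← inner_sub_left]
      refine (real_inner_le_norm _ _).trans ?_
      gcongr
      rw [← dist_eq_norm]
      have hx' : x ∈ Icc (0 : ℝ) 1 := ⟨(ha k).1.trans hx.1, hx.2.trans (ha (k + 1)).2⟩
      refine (hTδ x hx' (a k) (ha k) ?_).le
      rw [Real.dist_eq, abs_of_nonneg (by linarith [hx.1])]
      have h3 : (1 : ℝ) / N < δ := by rw [hN]; exact_mod_cast hn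
      linarith [hastep k, hx.2]
    rw [intervalIntegral.integral_const_mul] at e2
    linarith
  have ha0 : a 0 = 0 := by simp [a]
  have haN : a N = 1 := by simp [a]
  have hsum : ∀ {h : ℝ → ℝ}, IntervalIntegrable h volume 0 1 →
      ∑ k ∈ Finset.range N, ∫ x in a k..a (k + 1), h x = ∫ x in (0 : ℝ)..1, h x := by
    intro h hh
    rw [sum_integral_adjacent_intervals fun k _ =>
      intervalIntegrable_of_mem_Icc hh (ha k) (ha (k + 1)), ha0, haN]
  have htot : (∫ x in (0 : ℝ)..1, inner ℝ (T x) (g x)) ≤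
      (∑ k ∈ Finset.range N, dist (f (a (k + 1))) (f (a k))) + ε := by
    have := Finset.sum_le_sum fun k (_ : k ∈ Finset.range N) => key k
    rw [hsum (intervalIntegrable_inner hT hg), Finset.sum_add_distrib, ← Finset.mul_sum,
      hsum hg.norm, ← hJ] at this
    have h4 : ε / (J + 1) * J ≤ ε := by
      rw [div_mul_eq_mul_div, div_le_iff₀ (by linarith)]
      nlinarith [hε, ε.2]
    linarith
  calc ENNReal.ofReal (∫ x in (0 : ℝ)..1, inner ℝ (T x) (g x))
      ≤ ENNReal.ofReal ((∑ k ∈ Finset.range N, dist (f (a (k + 1))) (f (a k))) + ε) :=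
        ENNReal.ofReal_le_ofReal htot
    _ = (∑ k ∈ Finset.range N, edist (f (a (k + 1))) (f (a k))) + ε := by
        have hnn : ∀ k ∈ Finset.range N, 0 ≤ dist (f (a (k + 1))) (f (a k)) := fun _ _ =>
          dist_nonneg
        rw [ENNReal.ofReal_add (Finset.sum_nonneg hnn) ε.coe_nonneg,
          ENNReal.ofReal_sum_of_nonneg hnn,
          ENNReal.ofReal_coe_nnreal]
        simp only [edist_dist]
    _ ≤ eVariationOn (fun t : I => f t) univ + ε := by
        gcongr
        exact eVariationOn.sum_le (f := fun t : I => f t) (s := univ) (n := N)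
          (u := fun k => ⟨a k, ha k⟩) (fun k l hkl => hamono hkl) fun _ => mem_univ _

end Length

/-- The first variation of the length of a curve with derivative `g` and continuous unit tangent
field `T`. -/
theorem hasDerivAt_len {γ g T f : ℝ → E3} (hg : IntervalIntegrable g volume 0 1)
    (hγ : ∀ s ∈ Icc (0 : ℝ) 1, ∀ t ∈ Icc (0 : ℝ) 1, γ t - γ s = ∫ x in s..t, g x)
    (hT : Continuous T) (hT1 : ∀ x, ‖T x‖ = 1)
    (hgT : ∀ᵐ x ∂volume, x ∈ Ι (0 : ℝ) 1 → ∃ v > (0 : ℝ), g x = v • T x)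
    (hf : ContDiff ℝ 1 f) :
    HasDerivAt (fun r : ℝ => len fun t : I => γ t + r • f t)
      (∫ x in (0 : ℝ)..1, inner ℝ (T x) (deriv f x)) 0 := by
  have hf'c : Continuous (deriv f) := hf.continuous_deriv le_rfl
  have hfi : ∀ s t : ℝ, IntervalIntegrable (deriv f) volume s t := fun s t =>
    hf'c.intervalIntegrable s t
  have hG : ∀ r : ℝ, IntervalIntegrable (fun x => g x + r • deriv f x) volume 0 1 := fun r =>
    hg.add ((hfi 0 1).smul r)
  have hF : ∀ r : ℝ, ∀ s ∈ Icc (0 : ℝ) 1, ∀ t ∈ Icc (0 : ℝ) 1,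
      (γ t + r • f t) - (γ s + r • f s) = ∫ x in s..t, (g x + r • deriv f x) := by
    intro r s hs t ht
    have hrf : IntervalIntegrable (fun x => r • deriv f x) volume s t := (hfi s t).smul r
    rw [intervalIntegral.integral_add (intervalIntegrable_of_mem_Icc hg hs ht) hrf,
      ← hγ s hs t ht, intervalIntegral.integral_smul,
      integral_deriv_eq_sub (fun x _ => (hf.differentiable one_ne_zero) x) (hfi s t)]
    module
  have hup : ∀ r : ℝ, len (fun t : I => γ t + r • f t) ≤
      ∫ x in (0 : ℝ)..1, ‖g x + r • deriv f x‖ := fun r =>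
    ENNReal.toReal_le_of_le_ofReal
      (intervalIntegral.integral_nonneg zero_le_one fun _ _ => norm_nonneg _)
      (eVariationOn_le_integral_norm (f := fun t => γ t + r • f t) (hG r) (hF r))
  have hfin : ∀ r : ℝ, eVariationOn (fun t : I => γ t + r • f t) univ ≠ ⊤ := fun r =>
    ne_top_of_le_ne_top ENNReal.ofReal_ne_top
      (eVariationOn_le_integral_norm (f := fun t => γ t + r • f t) (hG r) (hF r))
  have hlow : ∀ r : ℝ, (∫ x in (0 : ℝ)..1, inner ℝ (T x) (g x)) +
      r * (∫ x in (0 : ℝ)..1, inner ℝ (T x) (deriv f x)) ≤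
      len (fun t : I => γ t + r • f t) := by
    intro r
    have h := ofReal_integral_inner_le_eVariationOn (f := fun t => γ t + r • f t) (hG r) (hF r) hT
      fun x => (hT1 x).le
    have h' := (ENNReal.ofReal_le_iff_le_toReal (hfin r)).1 h
    refine le_trans (le_of_eq ?_) h'
    simp only [inner_add_right, inner_smul_right]
    rw [intervalIntegral.integral_add (intervalIntegrable_inner hT hg)
      ((intervalIntegrable_inner hT (hfi 0 1)).const_mul r), intervalIntegral.integral_const_mul]
  have hz : (∫ x in (0 : ℝ)..1, ‖g x‖) = ∫ x in (0 : ℝ)..1, inner ℝ (T x) (g x) := by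
    refine integral_congr_ae ?_
    filter_upwards [hgT] with x hx hx1
    obtain ⟨v, hv, e⟩ := hx hx1
    rw [e, norm_smul, inner_smul_right, real_inner_self_eq_norm_sq, hT1, Real.norm_eq_abs,
      abs_of_pos hv]
    ring
  have hder : HasDerivAt (fun r : ℝ => ∫ x in (0 : ℝ)..1, ‖g x + r • deriv f x‖)
      (∫ x in (0 : ℝ)..1, inner ℝ (T x) (deriv f x)) 0 := by
    refine (intervalIntegral.hasDerivAt_integral_of_dominated_loc_of_lip (s := univ)
      (bound := fun x => ‖deriv f x‖) (F' := fun x => inner ℝ (T x) (deriv f x))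
      univ_mem ?_ ?_ ?_ ?_ ?_ ?_).2
    · exact Eventually.of_forall fun r => (hG r).norm.aestronglyMeasurable_restrict_uIoc
    · simpa using (hG 0).norm
    · exact (hT.inner hf'c).aestronglyMeasurable
    · refine Eventually.of_forall fun x _ => ?_
      refine LipschitzOnWith.of_dist_le_mul fun r _ s _ => ?_
      rw [Real.dist_eq]
      refine (abs_norm_sub_norm_le _ _).trans (le_of_eq ?_)
      rw [add_sub_add_left_eq_sub, ← sub_smul, norm_smul, Real.coe_nnabs, Real.dist_eq,
        Real.norm_eq_abs, abs_of_nonneg (norm_nonneg _)]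
      ring
    · exact (hfi 0 1).norm
    · filter_upwards [hgT] with x hx hx1
      obtain ⟨v, hv, e⟩ := hx hx1
      have hne : g x ≠ 0 := by
        rw [e]; exact smul_ne_zero hv.ne' (by rw [← norm_pos_iff, hT1]; norm_num)
      have h1 : HasDerivAt (fun r : ℝ => g x + r • deriv f x) (deriv f x) 0 := by
        simpa using ((hasDerivAt_id (0 : ℝ)).smul_const (deriv f x)).const_add (g x)
      have h2 := (h1.norm_sq).sqrt (by simpa using hne)
      simp only [Real.sqrt_sq (norm_nonneg _), zero_smul, add_zero] at h2
      refine h2.congr_deriv ?_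
      rw [e, norm_smul, inner_smul_left, hT1, Real.norm_eq_abs, abs_of_pos hv]
      simp only [conj_trivial]
      field_simp
  have hlen0 : len (fun t : I => γ t + (0 : ℝ) • f t) = ∫ x in (0 : ℝ)..1, inner ℝ (T x) (g x) := by
    refine le_antisymm ?_ (by simpa using hlow 0)
    rw [← hz]; simpa using hup 0
  rw [hasDerivAt_iff_isLittleO] at hder ⊢
  -- The length lies between the integral of the speed and the affine function in `hlow`, which is
  -- the tangent line of that integral at `r = 0`. The gap above the tangent line is therefore
  -- `o(r)`.
  refine (Asymptotics.IsBigO.of_norm_le fun r => ?_).trans_isLittleO hder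
  have h1 := hlow r
  have h2 := hup r
  rw [hlen0]
  simp only [sub_zero, zero_smul, add_zero, hz, smul_eq_mul, Real.norm_eq_abs]
  rw [abs_of_nonneg (by linarith)]
  linarith

/-! ### Right derivatives of minima of compact families. -/

section Danskin

variable {Q : Type*} [TopologicalSpace Q] [CompactSpace Q] [Nonempty Q]

/-- A minimum of a compact family of affine functions has a right derivative, which is at most
the slope of every active member of the family. -/
theorem hasDerivWithinAt_iInf_affine {a b : Q → ℝ} (ha : Continuous a) (hb : Continuous b) :
    ∃ d : ℝ, HasDerivWithinAt (fun r : ℝ => ⨅ q, (a q + r * b q)) d (Ici 0) 0 ∧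
      ∀ q, (a q = ⨅ q, a q) → d ≤ b q := by
  have hbdd : ∀ r : ℝ, BddBelow (range fun q => a q + r * b q) := fun r =>
    (isCompact_range (by fun_prop)).bddBelow
  -- An infimum of affine functions is concave, which already gives the right derivative; active
  -- members bound all its difference quotients from above.
  have hconc : ConvexOn ℝ univ (fun r : ℝ => -⨅ q, (a q + r * b q)) := by
    refine ConcaveOn.neg ⟨convex_univ, fun x _ y _ s t hs ht hst => ?_⟩
    refine le_ciInf fun q => ?_
    have h1 := mul_le_mul_of_nonneg_left (ciInf_le (hbdd x) q) hs
    have h2 := mul_le_mul_of_nonneg_left (ciInf_le (hbdd y) q) ht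
    simp only [smul_eq_mul]
    have : a q + (s * x + t * y) * b q = s * (a q + x * b q) + t * (a q + y * b q) := by
      have : a q = (s + t) * a q := by rw [hst, one_mul]
      linear_combination this
    linarith
  have hd := (hconc.hasDerivWithinAt_rightDeriv_of_mem_interior (x := 0) (by simp)).neg
  simp only [Pi.neg_def, neg_neg] at hd
  refine ⟨_, hasDerivWithinAt_Ioi_iff_Ici.1 hd, fun q hq => ?_⟩
  rw [hasDerivWithinAt_iff_tendsto_slope' (by simp)] at hd
  refine le_of_tendsto hd ?_
  filter_upwards [self_mem_nhdsWithin] with r hr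
  have hr' : (0 : ℝ) < r := hr
  rw [slope_def_field, sub_zero, div_le_iff₀ hr']
  have := ciInf_le (hbdd r) q
  rw [show (⨅ q, (a q + 0 * b q)) = a q by simp [hq] ]
  linarith

/-- A function that agrees to second order with a minimum of a compact family of affine
functions has the same right derivative. -/
theorem exists_hasDerivWithinAt_of_affine_bounds {a b : Q → ℝ} (ha : Continuous a)
    (hb : Continuous b) {F : ℝ → ℝ} {C : ℝ}
    (hlow : ∀ r, 0 ≤ r → (⨅ q, (a q + r * b q)) ≤ F r)
    (hup : ∀ r, 0 ≤ r → F r ≤ (⨅ q, (a q + r * b q)) + C * r ^ 2) :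
    ∃ d : ℝ, HasDerivWithinAt F d (Ici 0) 0 ∧ ∀ q, (a q = ⨅ q, a q) → d ≤ b q := by
  obtain ⟨d, hd, hdb⟩ := hasDerivWithinAt_iInf_affine ha hb
  refine ⟨d, ?_, hdb⟩
  have hrem : HasDerivWithinAt (fun r => F r - ⨅ q, (a q + r * b q)) 0 (Ici 0) 0 := by
    have h0 : F 0 - (⨅ q, (a q + 0 * b q)) = 0 := by
      have := hlow 0 le_rfl
      have := hup 0 le_rfl
      simp at *
      linarith
    rw [hasDerivWithinAt_iff_isLittleO]
    simp only [h0, sub_zero, smul_zero]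
    have h2 : (fun r : ℝ => C * r ^ 2) =o[𝓝[Ici 0] 0] fun r => r :=
      (((Asymptotics.isLittleO_pow_id (by norm_num : 1 < 2)).mono
        nhdsWithin_le_nhds).const_mul_left C)
    refine Asymptotics.IsBigO.trans_isLittleO ?_ h2
    refine Asymptotics.IsBigO.of_bound 1 ?_
    filter_upwards [self_mem_nhdsWithin] with r hr
    have h3 := hlow r hr
    have h4 := hup r hr
    rw [one_mul, Real.norm_eq_abs, Real.norm_eq_abs, abs_of_nonneg (by linarith)]
    exact (by linarith : _ ≤ C * r ^ 2).trans (le_abs_self _)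
  have := hrem.add hd
  rw [zero_add] at this
  refine this.congr_of_eventuallyEq (Eventually.of_forall fun r => ?_) ?_ <;>
    simp only [Pi.add_apply, sub_add_cancel]

end Danskin

/-! ### The profile of an arc: horizontal coordinate, speed and rise. -/

section Profile

variable {τ : Fin 2 → ℝ}

theorem partner_neg (τ : Fin 2 → ℝ) (i : Fin 2) (u : ℝ) : partner τ i (-u) = partner τ i u := by
  simp [partner]

theorem partner_zero (τ : Fin 2 → ℝ) (i : Fin 2) : partner τ i 0 = τ i.rev := by
  simp [partner]

theorem partner_self (hτ : ∀ i, 0 < τ i ∧ τ i ≤ 1) (i : Fin 2) : partner τ i (τ i) = 0 := by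
  have := (hτ i).1
  simp [partner, abs_of_pos this, this.ne']

theorem partner_mem (hτ : ∀ i, 0 < τ i ∧ τ i ≤ 1) (i : Fin 2) {u : ℝ} (hu : |u| ≤ τ i) :
    partner τ i u ∈ Icc 0 (τ i.rev) := by
  have h1 : |u| / τ i ≤ 1 := (div_le_one (hτ i).1).2 hu
  have h2 : 0 ≤ |u| / τ i := div_nonneg (abs_nonneg _) (hτ i).1.le
  have h3 := (hτ i.rev).1
  constructor <;> unfold partner <;> nlinarith

theorem partner_mem_Ioo (hτ : ∀ i, 0 < τ i ∧ τ i ≤ 1) (i : Fin 2) {u : ℝ}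
    (hu : u ∈ Ioo 0 (τ i)) : partner τ i u ∈ Ioo 0 (τ i.rev) := by
  have h1 : |u| / τ i < 1 := (div_lt_one (hτ i).1).2 (by rw [abs_of_pos hu.1]; exact hu.2)
  have h2 : 0 < |u| / τ i := div_pos (abs_pos.2 hu.1.ne') (hτ i).1
  have h3 := (hτ i.rev).1
  constructor <;> unfold partner <;> nlinarith

theorem partner_antitone (hτ : ∀ i, 0 < τ i ∧ τ i ≤ 1) (i : Fin 2) {u v : ℝ} (h : |u| ≤ |v|) :
    partner τ i v ≤ partner τ i u := by
  have h3 := (hτ i.rev).1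
  have h4 := (hτ i).1
  unfold partner
  gcongr

/-- Since both `τ` are at most 1, the partner of `u` is at most `1 - |u|`, and `|u| (1 - |u|) ≤
1/4`. This keeps the denominator `1 - u² v²` away from zero, even for `τ = 1`. -/
theorem sq_mul_sq_partner_le (hτ : ∀ i, 0 < τ i ∧ τ i ≤ 1) (i : Fin 2) {u : ℝ}
    (hu : |u| ≤ τ i) : u ^ 2 * partner τ i u ^ 2 ≤ 1 / 16 := by
  have h0 := partner_mem hτ i hu
  have h1 : partner τ i u ≤ 1 - |u| := by
    have h2 : |u| ≤ |u| / τ i := le_div_self (abs_nonneg _) (hτ i).1 (hτ i).2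
    have h3 : |u| / τ i ≤ 1 := (div_le_one (hτ i).1).2 hu
    have h4 := hτ i.rev
    unfold partner
    nlinarith
  have h2 : |u| * partner τ i u ≤ 1 / 4 := by
    have := mul_le_mul_of_nonneg_left h1 (abs_nonneg u)
    nlinarith [sq_nonneg (|u| - 1 / 2)]
  have h3 : 0 ≤ |u| * partner τ i u := mul_nonneg (abs_nonneg _) h0.1
  rw [← sq_abs u, ← mul_pow]
  nlinarith

theorem one_sub_sq_mul_sq_pos (hτ : ∀ i, 0 < τ i ∧ τ i ≤ 1) (i : Fin 2) {u : ℝ}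
    (hu : |u| ≤ τ i) : 0 < 1 - u ^ 2 * partner τ i u ^ 2 := by
  linarith [sq_mul_sq_partner_le hτ i hu]

theorem one_sub_sq_nonneg (hτ : ∀ i, 0 < τ i ∧ τ i ≤ 1) (i : Fin 2) {u : ℝ} (hu : |u| ≤ τ i) :
    0 ≤ 1 - u ^ 2 := by
  have : |u| ≤ 1 := hu.trans (hτ i).2
  rw [← sq_abs]
  nlinarith [abs_nonneg u]

theorem one_sub_sq_pos (hτ : ∀ i, 0 < τ i ∧ τ i ≤ 1) (i : Fin 2) {u : ℝ} (hu : |u| < τ i) :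
    0 < 1 - u ^ 2 := by
  have : |u| < 1 := hu.trans_le (hτ i).2
  rw [← sq_abs]
  nlinarith [abs_nonneg u]

theorem one_sub_partner_sq_nonneg (hτ : ∀ i, 0 < τ i ∧ τ i ≤ 1) (i : Fin 2) {u : ℝ}
    (hu : |u| ≤ τ i) : 0 ≤ 1 - partner τ i u ^ 2 := by
  have h := partner_mem hτ i hu
  exact one_sub_sq_nonneg hτ i.rev (by rw [abs_of_nonneg h.1]; exact h.2)

theorem claspX_neg (τ : Fin 2 → ℝ) (i : Fin 2) (u : ℝ) : claspX τ i (-u) = -claspX τ i u := by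
  simp [claspX, partner_neg]

theorem claspX_zero (τ : Fin 2 → ℝ) (i : Fin 2) : claspX τ i 0 = 0 := by simp [claspX]

theorem claspX_self (hτ : ∀ i, 0 < τ i ∧ τ i ≤ 1) (i : Fin 2) : claspX τ i (τ i) = τ i := by
  simp [claspX, partner_self hτ]

theorem claspX_sq (hτ : ∀ i, 0 < τ i ∧ τ i ≤ 1) (i : Fin 2) {u : ℝ} (hu : |u| ≤ τ i) :
    claspX τ i u ^ 2 = u ^ 2 * (1 - partner τ i u ^ 2) / (1 - u ^ 2 * partner τ i u ^ 2) := by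
  unfold claspX
  rw [mul_pow, Real.sq_sqrt (div_nonneg (one_sub_partner_sq_nonneg hτ i hu)
    (one_sub_sq_mul_sq_pos hτ i hu).le), mul_div_assoc]

/-- This compares the singular factor `1 / √(1 - u²)` of the speed with the one in the derivative of
`arcsin ∘ claspX`. -/
theorem one_sub_claspX_sq (hτ : ∀ i, 0 < τ i ∧ τ i ≤ 1) (i : Fin 2) {u : ℝ} (hu : |u| ≤ τ i) :
    1 - claspX τ i u ^ 2 = (1 - u ^ 2) / (1 - u ^ 2 * partner τ i u ^ 2) := by
  rw [claspX_sq hτ i hu]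
  have := (one_sub_sq_mul_sq_pos hτ i hu).ne'
  field_simp
  ring

theorem claspX_nonneg (τ : Fin 2 → ℝ) (i : Fin 2) {u : ℝ} (hu : 0 ≤ u) : 0 ≤ claspX τ i u :=
  mul_nonneg hu (Real.sqrt_nonneg _)

theorem claspX_pos (hτ : ∀ i, 0 < τ i ∧ τ i ≤ 1) (i : Fin 2) {u : ℝ} (hu : u ∈ Ioc 0 (τ i)) :
    0 < claspX τ i u := by
  have hu' : |u| ≤ τ i := by rw [abs_of_pos hu.1]; exact hu.2
  refine mul_pos hu.1 (Real.sqrt_pos.2 (div_pos ?_ (one_sub_sq_mul_sq_pos hτ i hu')))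
  have h1 := partner_mem hτ i hu'
  -- Strictness needs `u > 0`: at the tip the partner is the other `τ`, which may equal 1.
  have h2 : partner τ i u < 1 := by
    have h3 : 0 < |u| / τ i := div_pos (abs_pos.2 hu.1.ne') (hτ i).1
    have h4 := hτ i.rev
    unfold partner
    nlinarith
  nlinarith [h1.1]

theorem continuous_partner (τ : Fin 2 → ℝ) (i : Fin 2) : Continuous (partner τ i) := by
  unfold partner
  fun_prop

theorem continuousOn_claspX (hτ : ∀ i, 0 < τ i ∧ τ i ≤ 1) (i : Fin 2) :
    ContinuousOn (claspX τ i) (Icc (-τ i) (τ i)) := by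
  have hp := continuous_partner τ i
  refine continuousOn_id.mul (ContinuousOn.sqrt (ContinuousOn.div ?_ ?_ fun u hu => ?_))
  · fun_prop
  · fun_prop
  · exact ne_of_gt (one_sub_sq_mul_sq_pos hτ i (abs_le.2 hu))

/-- The derivative of `claspX` between the tip and the end of the curved part. -/
def slopeX (τ : Fin 2 → ℝ) (i : Fin 2) (u : ℝ) : ℝ :=
  (u * (1 - partner τ i u ^ 2) +
    partner τ i u * (τ i.rev / τ i) * u ^ 2 * (1 - u ^ 2)) /
      ((1 - u ^ 2 * partner τ i u ^ 2) ^ 2 * claspX τ i u)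

theorem hasDerivAt_claspX (hτ : ∀ i, 0 < τ i ∧ τ i ≤ 1) (i : Fin 2) {u : ℝ}
    (hu : u ∈ Ioo 0 (τ i)) : HasDerivAt (claspX τ i) (slopeX τ i u) u := by
  have hu' : |u| ≤ τ i := by rw [abs_of_pos hu.1]; exact hu.2.le
  have hD := one_sub_sq_mul_sq_pos hτ i hu'
  have hx := claspX_pos hτ i ⟨hu.1, hu.2.le⟩
  have hp : HasDerivAt (partner τ i) (-(τ i.rev / τ i)) u := by
    have h1 : HasDerivAt (fun s : ℝ => τ i.rev * (1 - s / τ i)) (τ i.rev * (-(1 / τ i))) u :=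
      (((hasDerivAt_id u).div_const (τ i)).const_sub 1).const_mul _
    refine (h1.congr_of_eventuallyEq ?_).congr_deriv (by ring)
    filter_upwards [lt_mem_nhds hu.1] with s hs
    simp [partner, abs_of_pos hs]
  have hN : HasDerivAt (fun s => s ^ 2 * (1 - partner τ i s ^ 2))
      (2 * u * (1 - partner τ i u ^ 2) + u ^ 2 * (2 * partner τ i u * (τ i.rev / τ i))) u :=
    ((hasDerivAt_pow 2 u).mul ((hp.pow 2).const_sub 1)).congr_deriv (by
      simp only [Pi.pow_apply]; push_cast; ring)
  have hQ : HasDerivAt (fun s => 1 - s ^ 2 * partner τ i s ^ 2)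
      (-(2 * u * partner τ i u ^ 2 - u ^ 2 * (2 * partner τ i u * (τ i.rev / τ i)))) u :=
    (((hasDerivAt_pow 2 u).mul (hp.pow 2)).const_sub 1).congr_deriv (by
      simp only [Pi.pow_apply]; push_cast; ring)
  -- For `u > 0` the coordinate is the root of its square, a rational function of `u`. At `0` the
  -- modulus in `partner` and the possible vanishing of the root make an open interval necessary.
  have hsq := claspX_sq hτ i hu'
  have hy := (hN.div hQ hD.ne').sqrt (by
    simp only [Pi.div_apply]; rw [← hsq]; positivity)
  have hev : claspX τ i =ᶠ[𝓝 u] fun s =>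
      √(s ^ 2 * (1 - partner τ i s ^ 2) / (1 - s ^ 2 * partner τ i s ^ 2)) := by
    filter_upwards [Ioo_mem_nhds hu.1 hu.2] with s hs
    rw [← claspX_sq hτ i (by rw [abs_of_pos hs.1]; exact hs.2.le),
      Real.sqrt_sq (claspX_nonneg τ i hs.1.le)]
  refine (hy.congr_of_eventuallyEq hev).congr_deriv ?_
  simp only [Pi.div_apply]
  rw [← hsq, Real.sqrt_sq hx.le, slopeX]
  field_simp
  ring

theorem slopeX_pos (hτ : ∀ i, 0 < τ i ∧ τ i ≤ 1) (i : Fin 2) {u : ℝ} (hu : u ∈ Ioo 0 (τ i)) :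
    0 < slopeX τ i u := by
  have hu' : |u| < τ i := by rw [abs_of_pos hu.1]; exact hu.2
  have hD := one_sub_sq_mul_sq_pos hτ i hu'.le
  have hx := claspX_pos hτ i ⟨hu.1, hu.2.le⟩
  have hp := partner_mem_Ioo hτ i hu
  have h1 := one_sub_sq_pos hτ i hu'
  have h2 := one_sub_partner_sq_nonneg hτ i hu'.le
  have h3 := (hτ i.rev).1
  have h4 := (hτ i).1
  have h5 := hp.1
  have h6 := hu.1
  unfold slopeX
  positivity

theorem continuousOn_slopeX (hτ : ∀ i, 0 < τ i ∧ τ i ≤ 1) (i : Fin 2) :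
    ContinuousOn (slopeX τ i) (Ioo 0 (τ i)) := by
  have hp := (continuous_partner τ i).continuousOn (s := Ioo 0 (τ i))
  have hx : ContinuousOn (claspX τ i) (Ioo 0 (τ i)) :=
    (continuousOn_claspX hτ i).mono fun u hu => ⟨by linarith [hu.1, (hτ i).1], hu.2.le⟩
  unfold slopeX
  refine ContinuousOn.div (by fun_prop) (by fun_prop) fun u hu => ?_
  have hu' : |u| < τ i := by rw [abs_of_pos hu.1]; exact hu.2
  have hD := one_sub_sq_mul_sq_pos hτ i hu'.le
  have := claspX_pos hτ i ⟨hu.1, hu.2.le⟩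
  positivity

theorem monotoneOn_claspX (hτ : ∀ i, 0 < τ i ∧ τ i ≤ 1) (i : Fin 2) :
    MonotoneOn (claspX τ i) (Icc 0 (τ i)) := by
  refine monotoneOn_of_deriv_nonneg (convex_Icc _ _)
    ((continuousOn_claspX hτ i).mono fun u hu => ⟨by linarith [hu.1, (hτ i).1], hu.2⟩) ?_ ?_
  · rw [interior_Icc]
    exact fun u hu => (hasDerivAt_claspX hτ i hu).differentiableAt.differentiableWithinAt
  · rw [interior_Icc]
    exact fun u hu => by rw [(hasDerivAt_claspX hτ i hu).deriv]; exact (slopeX_pos hτ i hu).le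

/-- The speed of the curved part in the parameter `u`, for `0 < u < τ i`. -/
def curvedSpeed (τ : Fin 2 → ℝ) (i : Fin 2) (u : ℝ) : ℝ := slopeX τ i u / √(1 - u ^ 2)

theorem curvedSpeed_pos (hτ : ∀ i, 0 < τ i ∧ τ i ≤ 1) (i : Fin 2) {u : ℝ}
    (hu : u ∈ Ioo 0 (τ i)) : 0 < curvedSpeed τ i u :=
  div_pos (slopeX_pos hτ i hu)
    (Real.sqrt_pos.2 (one_sub_sq_pos hτ i (by rw [abs_of_pos hu.1]; exact hu.2)))

theorem sqrt_mul_curvedSpeed (hτ : ∀ i, 0 < τ i ∧ τ i ≤ 1) (i : Fin 2) {u : ℝ}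
    (hu : u ∈ Ioo 0 (τ i)) : √(1 - u ^ 2) * curvedSpeed τ i u = slopeX τ i u :=
  mul_div_cancel₀ _
    (Real.sqrt_pos.2 (one_sub_sq_pos hτ i (by rw [abs_of_pos hu.1]; exact hu.2))).ne'

theorem continuousOn_curvedSpeed (hτ : ∀ i, 0 < τ i ∧ τ i ≤ 1) (i : Fin 2) :
    ContinuousOn (curvedSpeed τ i) (Ioo 0 (τ i)) := by
  refine (continuousOn_slopeX hτ i).div (by fun_prop) fun u hu => ?_
  exact ne_of_gt (Real.sqrt_pos.2 (one_sub_sq_pos hτ i (by rw [abs_of_pos hu.1]; exact hu.2)))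

/-- The curved part has finite length, even where it becomes vertical: up to a bounded factor
the speed is the derivative of the monotone function `arcsin ∘ claspX`. -/
theorem intervalIntegrable_curvedSpeed (hτ : ∀ i, 0 < τ i ∧ τ i ≤ 1) (i : Fin 2) :
    IntervalIntegrable (curvedSpeed τ i) volume 0 (τ i) := by
  have h0 := (hτ i).1
  have hcl : ∀ u ∈ Icc 0 (τ i), |u| ≤ τ i := fun u hu => by rw [abs_of_nonneg hu.1]; exact hu.2
  have h1 : IntervalIntegrable (fun u => 1 / √(1 - claspX τ i u ^ 2) * slopeX τ i u)
      volume 0 (τ i) := by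
    refine intervalIntegrable_deriv_of_nonneg (g := fun u => Real.arcsin (claspX τ i u)) ?_ ?_ ?_
    · rw [uIcc_of_le h0.le]
      exact Real.continuous_arcsin.comp_continuousOn
        ((continuousOn_claspX hτ i).mono fun u hu => ⟨by linarith [hu.1], hu.2⟩)
    · rw [min_eq_left h0.le, max_eq_right h0.le]
      intro u hu
      have hu' : |u| < τ i := by rw [abs_of_pos hu.1]; exact hu.2
      have hlt : 0 < 1 - claspX τ i u ^ 2 := by
        rw [one_sub_claspX_sq hτ i hu'.le]
        exact div_pos (one_sub_sq_pos hτ i hu') (one_sub_sq_mul_sq_pos hτ i hu'.le)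
      have hx := claspX_nonneg τ i hu.1.le
      exact (Real.hasDerivAt_arcsin (by nlinarith) (by nlinarith)).comp u
        (hasDerivAt_claspX hτ i hu)
    · rw [min_eq_left h0.le, max_eq_right h0.le]
      intro u hu
      have := slopeX_pos hτ i hu
      positivity
  have h2 : ContinuousOn (fun u => 1 / √(1 - u ^ 2 * partner τ i u ^ 2)) [[0, τ i]] := by
    have hp := continuous_partner τ i
    rw [uIcc_of_le h0.le]
    refine ContinuousOn.div continuousOn_const (by fun_prop) fun u hu => ?_
    exact (Real.sqrt_pos.2 (one_sub_sq_mul_sq_pos hτ i (hcl u hu))).ne'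
  -- By `one_sub_claspX_sq` the bounded factor relating the speed to the derivative of `arcsin ∘
  -- claspX` is `1 / √(1 - u² v²)`.
  refine (h1.mul_continuousOn h2).congr_uIoo fun u hu => ?_
  rw [uIoo_of_le h0.le] at hu
  have hu' := hcl u (Ioo_subset_Icc_self hu)
  have h3 := (Real.sqrt_pos.2 (one_sub_sq_mul_sq_pos hτ i hu')).ne'
  have h4 := (Real.sqrt_pos.2 (one_sub_sq_pos hτ i
    (by rw [abs_of_pos hu.1]; exact hu.2))).ne'
  simp only [curvedSpeed]
  rw [one_sub_claspX_sq hτ i hu', Real.sqrt_div (one_sub_sq_nonneg hτ i hu')]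
  field_simp

theorem riseIntegrand_eq (hτ : ∀ i, 0 < τ i ∧ τ i ≤ 1) (i : Fin 2) {u : ℝ}
    (hu : u ∈ Ioo 0 (τ i)) :
    u / √(1 - u ^ 2) * deriv (claspX τ i) u = u * curvedSpeed τ i u := by
  rw [(hasDerivAt_claspX hτ i hu).deriv, curvedSpeed]
  ring

theorem intervalIntegrable_riseIntegrand (hτ : ∀ i, 0 < τ i ∧ τ i ≤ 1) (i : Fin 2) :
    IntervalIntegrable (fun u => u / √(1 - u ^ 2) * deriv (claspX τ i) u) volume 0 (τ i) := by
  refine ((intervalIntegrable_curvedSpeed hτ i).continuousOn_mul continuousOn_id).congr_uIoo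
    fun u hu => ?_
  rw [uIoo_of_le (hτ i).1.le] at hu
  exact (riseIntegrand_eq hτ i hu).symm

theorem claspRise_neg (τ : Fin 2 → ℝ) (i : Fin 2) (u : ℝ) :
    claspRise τ i (-u) = claspRise τ i u := by
  simp [claspRise]

theorem claspRise_zero (τ : Fin 2 → ℝ) (i : Fin 2) : claspRise τ i 0 = 0 := by simp [claspRise]

theorem continuousOn_claspRise (hτ : ∀ i, 0 < τ i ∧ τ i ≤ 1) (i : Fin 2) :
    ContinuousOn (claspRise τ i) (Icc (-τ i) (τ i)) := by
  have h := continuousOn_primitive_interval' (intervalIntegrable_riseIntegrand hτ i) left_mem_uIcc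
  rw [uIcc_of_le (hτ i).1.le] at h
  exact h.comp continuous_abs.continuousOn fun u hu => ⟨abs_nonneg u, abs_le.2 hu⟩

theorem hasDerivAt_claspRise (hτ : ∀ i, 0 < τ i ∧ τ i ≤ 1) (i : Fin 2) {u : ℝ}
    (hu : u ∈ Ioo 0 (τ i)) : HasDerivAt (claspRise τ i) (u * curvedSpeed τ i u) u := by
  have hcont : ContinuousOn (fun s => s / √(1 - s ^ 2) * deriv (claspX τ i) s)
      (Ioo 0 (τ i)) :=
    (continuousOn_id.mul (continuousOn_curvedSpeed hτ i)).congr fun s hs =>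
      riseIntegrand_eq hτ i hs
  have hnhds := Ioo_mem_nhds hu.1 hu.2
  have h := integral_hasDerivAt_right (a := 0) (b := u)
    ((intervalIntegrable_riseIntegrand hτ i).mono_set (by
      rw [uIcc_of_le hu.1.le, uIcc_of_le (hτ i).1.le]; exact Icc_subset_Icc_right hu.2.le))
    (hcont.stronglyMeasurableAtFilter isOpen_Ioo u hu) (hcont.continuousAt hnhds)
  rw [riseIntegrand_eq hτ i hu] at h
  refine h.congr_of_eventuallyEq ?_
  filter_upwards [hnhds] with s hs
  simp [claspRise, abs_of_pos hs.1]

theorem strictMonoOn_claspRise (hτ : ∀ i, 0 < τ i ∧ τ i ≤ 1) (i : Fin 2) :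
    StrictMonoOn (claspRise τ i) (Icc 0 (τ i)) := by
  refine strictMonoOn_of_deriv_pos (convex_Icc _ _)
    ((continuousOn_claspRise hτ i).mono fun u hu => ⟨by linarith [hu.1, (hτ i).1], hu.2⟩) ?_
  rw [interior_Icc]
  exact fun u hu => by
    rw [(hasDerivAt_claspRise hτ i hu).deriv]
    exact mul_pos hu.1 (curvedSpeed_pos hτ i hu)

end Profile

/-! ### Struts: force balance, unit length and closing up. -/

section Struts

variable {τ : Fin 2 → ℝ}

/-- The height of a strut between points with parameters `u` and `v`. -/
def strutHeight (u v : ℝ) : ℝ := √((1 - u ^ 2) * (1 - v ^ 2) / (1 - u ^ 2 * v ^ 2))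

theorem strutHeight_nonneg (u v : ℝ) : 0 ≤ strutHeight u v := Real.sqrt_nonneg _

theorem strutHeight_comm (u v : ℝ) : strutHeight u v = strutHeight v u := by
  unfold strutHeight
  congr 1
  ring

/-- Force balance in scalar form: the in-plane part of a strut, with horizontal extent `claspX` and
vertical extent `strutHeight`, is orthogonal to the tangent. -/
theorem claspX_mul_sqrt (hτ : ∀ i, 0 < τ i ∧ τ i ≤ 1) (i : Fin 2) {u : ℝ} (hu : |u| ≤ τ i) :
    claspX τ i u * √(1 - u ^ 2) = u * strutHeight u (partner τ i u) := by
  have h1 := one_sub_sq_nonneg hτ i hu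
  rw [claspX, strutHeight, mul_assoc, mul_comm √(_ / _), ← Real.sqrt_mul h1, mul_div_assoc]

/-- Balanced pairs of parameters. -/
structure Balanced (τ : Fin 2 → ℝ) (u v : ℝ) : Prop where
  nonneg_left : 0 ≤ u
  nonneg_right : 0 ≤ v
  sum_eq : u / τ 0 + v / τ 1 = 1

theorem Balanced.partner_zero (hτ : ∀ i, 0 < τ i ∧ τ i ≤ 1) {u v : ℝ} (h : Balanced τ u v) :
    partner τ 0 u = v := by
  have h0 := (hτ 0).1.ne'
  have h1 := (hτ 1).1.ne'
  have h2 := h.sum_eq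
  simp only [partner, abs_of_nonneg h.nonneg_left, show Fin.rev (0 : Fin 2) = 1 from rfl]
  rw [← h2]
  field_simp
  ring

theorem Balanced.partner_one (hτ : ∀ i, 0 < τ i ∧ τ i ≤ 1) {u v : ℝ} (h : Balanced τ u v) :
    partner τ 1 v = u := by
  have h0 := (hτ 0).1.ne'
  have h1 := (hτ 1).1.ne'
  have h2 := h.sum_eq
  simp only [partner, abs_of_nonneg h.nonneg_right, show Fin.rev (1 : Fin 2) = 0 from rfl]
  rw [← h2]
  field_simp
  ring

theorem Balanced.left_le (hτ : ∀ i, 0 < τ i ∧ τ i ≤ 1) {u v : ℝ} (h : Balanced τ u v) :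
    u ≤ τ 0 := by
  have h1 := div_nonneg h.nonneg_right (hτ 1).1.le
  exact (div_le_one (hτ 0).1).1 (by linarith [h.sum_eq])

theorem Balanced.right_le (hτ : ∀ i, 0 < τ i ∧ τ i ≤ 1) {u v : ℝ} (h : Balanced τ u v) :
    v ≤ τ 1 := by
  have h1 := div_nonneg h.nonneg_left (hτ 0).1.le
  exact (div_le_one (hτ 1).1).1 (by linarith [h.sum_eq])

theorem balanced_partner_zero (hτ : ∀ i, 0 < τ i ∧ τ i ≤ 1) {u : ℝ} (h0 : 0 ≤ u)
    (h1 : u ≤ τ 0) : Balanced τ u (partner τ 0 u) := by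
  have hu : |u| ≤ τ 0 := by rwa [abs_of_nonneg h0]
  refine ⟨h0, (partner_mem hτ 0 hu).1, ?_⟩
  have h2 := (hτ 0).1.ne'
  have h3 := (hτ 1).1.ne'
  simp only [partner, abs_of_nonneg h0, show Fin.rev (0 : Fin 2) = 1 from rfl]
  field_simp
  ring

theorem Balanced.abs_left_le (hτ : ∀ i, 0 < τ i ∧ τ i ≤ 1) {u v : ℝ} (h : Balanced τ u v) :
    |u| ≤ τ 0 := by rw [abs_of_nonneg h.nonneg_left]; exact h.left_le hτ

theorem Balanced.abs_right_le (hτ : ∀ i, 0 < τ i ∧ τ i ≤ 1) {u v : ℝ} (h : Balanced τ u v) :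
    |v| ≤ τ 1 := by rw [abs_of_nonneg h.nonneg_right]; exact h.right_le hτ

theorem Balanced.denom_pos (hτ : ∀ i, 0 < τ i ∧ τ i ≤ 1) {u v : ℝ} (h : Balanced τ u v) :
    0 < 1 - u ^ 2 * v ^ 2 := by
  have := one_sub_sq_mul_sq_pos hτ 0 (h.abs_left_le hτ)
  rwa [h.partner_zero hτ] at this

theorem Balanced.strutHeight_sq (hτ : ∀ i, 0 < τ i ∧ τ i ≤ 1) {u v : ℝ} (h : Balanced τ u v) :
    strutHeight u v ^ 2 = (1 - u ^ 2) * (1 - v ^ 2) / (1 - u ^ 2 * v ^ 2) :=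
  Real.sq_sqrt (div_nonneg (mul_nonneg (one_sub_sq_nonneg hτ 0 (h.abs_left_le hτ))
    (one_sub_sq_nonneg hτ 1 (h.abs_right_le hτ))) (h.denom_pos hτ).le)

/-- The unit length of a strut, provided that its vertical extent is `strutHeight`. -/
theorem Balanced.sq_add_sq_add_sq (hτ : ∀ i, 0 < τ i ∧ τ i ≤ 1) {u v : ℝ}
    (h : Balanced τ u v) :
    claspX τ 0 u ^ 2 + claspX τ 1 v ^ 2 + strutHeight u v ^ 2 = 1 := by
  have hD := (h.denom_pos hτ).ne'
  have hD' : 1 - v ^ 2 * u ^ 2 ≠ 0 := by rwa [mul_comm]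
  rw [claspX_sq hτ 0 (h.abs_left_le hτ), claspX_sq hτ 1 (h.abs_right_le hτ),
    h.strutHeight_sq hτ, h.partner_zero hτ, h.partner_one hτ, mul_comm (v ^ 2) (u ^ 2)]
  field_simp
  ring

theorem Balanced.claspX_zero_mul_sqrt (hτ : ∀ i, 0 < τ i ∧ τ i ≤ 1) {u v : ℝ}
    (h : Balanced τ u v) : claspX τ 0 u * √(1 - u ^ 2) = u * strutHeight u v := by
  rw [claspX_mul_sqrt hτ 0 (h.abs_left_le hτ), h.partner_zero hτ]

theorem Balanced.claspX_one_mul_sqrt (hτ : ∀ i, 0 < τ i ∧ τ i ≤ 1) {u v : ℝ}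
    (h : Balanced τ u v) : claspX τ 1 v * √(1 - v ^ 2) = v * strutHeight u v := by
  rw [claspX_mul_sqrt hτ 1 (h.abs_right_le hτ), h.partner_one hτ, strutHeight_comm]

theorem continuous_strutHeight_partner (hτ : ∀ i, 0 < τ i ∧ τ i ≤ 1) :
    ContinuousOn (fun u => strutHeight u (partner τ 0 u)) (Icc 0 (τ 0)) := by
  have hp := continuous_partner τ 0
  refine ContinuousOn.sqrt (ContinuousOn.div (by fun_prop) (by fun_prop) fun u hu => ?_)
  exact ne_of_gt ((balanced_partner_zero hτ hu.1 hu.2).denom_pos hτ)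

/-- The struts close up: along balanced pairs the strut height accounts for the difference of
the heights of its endpoints. -/
theorem Balanced.rise_add_rise_add_strutHeight (hτ : ∀ i, 0 < τ i ∧ τ i ≤ 1) {u v : ℝ}
    (h : Balanced τ u v) :
    claspRise τ 0 u + claspRise τ 1 v + strutHeight u v = tipHeight τ 1 := by
  set D : ℝ → ℝ := fun s => claspRise τ 0 s + claspRise τ 1 (partner τ 0 s) +
    strutHeight s (partner τ 0 s) with hD
  have hD0 : D 0 = tipHeight τ 1 := by
    simp only [hD, Clasp.partner_zero, claspRise_zero, tipHeight,
      show Fin.rev (0 : Fin 2) = 1 from rfl, strutHeight]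
    norm_num
    ring
  rcases h.nonneg_left.eq_or_lt with hu | hu
  · rw [← hD0, hD]
    simp only
    rw [hu, h.partner_zero hτ]
  have hcont : ContinuousOn D (Icc 0 (τ 0)) := by
    refine ContinuousOn.add (ContinuousOn.add ?_ ?_) (continuous_strutHeight_partner hτ)
    · exact (continuousOn_claspRise hτ 0).mono fun s hs => ⟨by linarith [hs.1, (hτ 0).1], hs.2⟩
    · refine (continuousOn_claspRise hτ 1).comp (continuous_partner τ 0).continuousOn
        fun s hs => ?_
      have := partner_mem hτ 0 (u := s) (by rw [abs_of_nonneg hs.1]; exact hs.2)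
      exact ⟨by linarith [this.1, (hτ 1).1], this.2⟩
  have hderiv : ∀ s ∈ Ioo 0 (τ 0), HasDerivAt D 0 s := by
    intro s hs
    have hb := balanced_partner_zero hτ hs.1.le hs.2.le
    have hp := partner_mem_Ioo hτ 0 hs
    set w := partner τ 0 s with hw
    have hp' : HasDerivAt (partner τ 0) (-(τ 1 / τ 0)) s := by
      have h1 : HasDerivAt (fun s : ℝ => τ 1 * (1 - s / τ 0)) (τ 1 * (-(1 / τ 0))) s :=
        (((hasDerivAt_id s).div_const (τ 0)).const_sub 1).const_mul _
      refine (h1.congr_of_eventuallyEq ?_).congr_deriv (by ring)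
      filter_upwards [lt_mem_nhds hs.1] with r hr
      simp [partner, abs_of_pos hr]
    have hx0 := hasDerivAt_claspX hτ 0 hs
    have hx1 := (hasDerivAt_claspX hτ 1 hp).comp s hp'
    have hr0 := hasDerivAt_claspRise hτ 0 hs
    have hr1 := (hasDerivAt_claspRise hτ 1 hp).comp s hp'
    have hsu : 0 < 1 - s ^ 2 := one_sub_sq_pos hτ 0 (by rw [abs_of_pos hs.1]; exact hs.2)
    have hsv : 0 < 1 - w ^ 2 := one_sub_sq_pos hτ 1 (by rw [abs_of_pos hp.1]; exact hp.2)
    have hH : 0 < strutHeight s w :=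
      Real.sqrt_pos.2 (div_pos (mul_pos hsu hsv) (hb.denom_pos hτ))
    have hsq : 1 - claspX τ 0 s ^ 2 - claspX τ 1 w ^ 2 = strutHeight s w ^ 2 := by
      linarith [hb.sq_add_sq_add_sq hτ]
    -- The strut height is differentiated as `√(1 - x₁² - x₂²)`, so that only the derivatives of the
    -- horizontal coordinates enter.
    have hh := (((hx0.pow 2).const_sub 1).sub (hx1.pow 2)).sqrt (by
      simp only [Pi.sub_apply, Pi.pow_apply, Function.comp_apply]
      rw [← hw, hsq]; positivity)
    have hh' : HasDerivAt (fun r => strutHeight r (partner τ 0 r)) _ s :=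
      hh.congr_of_eventuallyEq (by
        filter_upwards [Ioo_mem_nhds hs.1 hs.2] with r hr
        have hb' := balanced_partner_zero hτ hr.1.le hr.2.le
        simp only [Pi.sub_apply, Pi.pow_apply, Function.comp_apply]
        rw [show 1 - claspX τ 0 r ^ 2 - claspX τ 1 (partner τ 0 r) ^ 2 =
          strutHeight r (partner τ 0 r) ^ 2 by linarith [hb'.sq_add_sq_add_sq hτ],
          Real.sqrt_sq (strutHeight_nonneg _ _)])
    refine ((hr0.add hr1).add hh').congr_deriv ?_
    simp only [Pi.sub_apply, Pi.pow_apply, Function.comp_apply]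
    rw [← hw, hsq, Real.sqrt_sq hH.le]
    -- Since `x' = √(1 - u²) * speed`, force balance turns `x x' / h` into `u * speed`, the
    -- derivative of the rise. The change of the strut height thus cancels those of the two rises.
    have e0 := hb.claspX_zero_mul_sqrt hτ
    have e1 := hb.claspX_one_mul_sqrt hτ
    rw [← sqrt_mul_curvedSpeed hτ 0 hs, ← sqrt_mul_curvedSpeed hτ 1 hp]
    have ht0 := (hτ 0).1.ne'
    field_simp
    push_cast
    simp only [pow_one]
    linear_combination (-2 * curvedSpeed τ 0 s * τ 0) * e0 + (2 * curvedSpeed τ 1 w * τ 1) * e1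
  obtain ⟨ξ, hξ, e⟩ := exists_hasDerivAt_eq_slope D (fun _ => 0) hu
    (hcont.mono (Icc_subset_Icc_right (h.left_le hτ)))
    (fun s hs => hderiv s ⟨hs.1, hs.2.trans_le (h.left_le hτ)⟩)
  have h2 : D u = D 0 := by
    rw [eq_comm, div_eq_zero_iff] at e
    rcases e with e | e <;> linarith
  rw [← hD0, ← h2, hD]
  simp only
  rw [h.partner_zero hτ]

end Struts

/-! ### Calculus in the two perpendicular coordinate planes. -/

section PlanePoint

theorem planePoint_eq (i : Fin 2) (x z : ℝ) :
    planePoint i x z = !₂[if i = 0 then x else 0, if i = 1 then x else 0, z] := by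
  ext k
  fin_cases i <;> fin_cases k <;> simp [planePoint]

theorem inner_planePoint (i j : Fin 2) (x z x' z' : ℝ) :
    inner ℝ (planePoint i x z) (planePoint j x' z') = (if i = j then x * x' else 0) + z * z' := by
  simp only [planePoint_eq, PiLp.inner_apply, Fin.sum_univ_three]
  fin_cases i <;> fin_cases j <;> simp [mul_comm]

theorem norm_sq_planePoint (i : Fin 2) (x z : ℝ) : ‖planePoint i x z‖ ^ 2 = x ^ 2 + z ^ 2 := by
  rw [← real_inner_self_eq_norm_sq, inner_planePoint]
  simp only [if_true]
  ring

theorem smul_planePoint (i : Fin 2) (a x z : ℝ) :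
    a • planePoint i x z = planePoint i (a * x) (a * z) := by
  simp only [planePoint_eq]
  ext k
  fin_cases i <;> fin_cases k <;> simp

theorem planePoint_add (i : Fin 2) (x z x' z' : ℝ) :
    planePoint i x z + planePoint i x' z' = planePoint i (x + x') (z + z') := by
  simp only [planePoint_eq]
  ext k
  fin_cases i <;> fin_cases k <;> simp

theorem planePoint_sub (i : Fin 2) (x z x' z' : ℝ) :
    planePoint i x z - planePoint i x' z' = planePoint i (x - x') (z - z') := by
  simp only [planePoint_eq]
  ext k
  fin_cases i <;> fin_cases k <;> simp

theorem planePoint_inj {i : Fin 2} {x z x' z' : ℝ} (h : planePoint i x z = planePoint i x' z') :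
    x = x' ∧ z = z' := by
  have h2 := congrArg (fun p : E3 => p 2) h
  have hi := congrArg (fun p : E3 => p i.castSucc) h
  fin_cases i <;> simp_all [planePoint_eq]

theorem planePoint_eq_planePoint_of_ne {i j : Fin 2} (hij : i ≠ j) {x z x' z' : ℝ}
    (h : planePoint i x z = planePoint j x' z') : x = 0 ∧ x' = 0 ∧ z = z' := by
  have h0 := congrArg (fun p : E3 => p 0) h
  have h1 := congrArg (fun p : E3 => p 1) h
  have h2 := congrArg (fun p : E3 => p 2) h
  fin_cases i <;> fin_cases j <;> simp_all [planePoint_eq]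

theorem continuous_planePoint {X : Type*} [TopologicalSpace X] (i : Fin 2) {f g : X → ℝ}
    (hf : Continuous f) (hg : Continuous g) : Continuous fun x => planePoint i (f x) (g x) := by
  have h : (fun x => planePoint i (f x) (g x)) = fun x =>
      f x • planePoint i 1 0 + g x • planePoint i 0 1 := by
    funext x
    rw [smul_planePoint, smul_planePoint, planePoint_add]
    simp
  rw [h]
  fun_prop

theorem hasDerivAt_planePoint (i : Fin 2) {f g : ℝ → ℝ} {f' g' s : ℝ}
    (hf : HasDerivAt f f' s) (hg : HasDerivAt g g' s) :
    HasDerivAt (fun x => planePoint i (f x) (g x)) (planePoint i f' g') s := by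
  have h : ∀ a b : ℝ, planePoint i a b = a • planePoint i 1 0 + b • planePoint i 0 1 := by
    intro a b
    rw [smul_planePoint, smul_planePoint, planePoint_add]
    simp
  have e : (fun x => planePoint i (f x) (g x)) = fun x =>
      f x • planePoint i 1 0 + g x • planePoint i 0 1 := funext fun x => h _ _
  rw [e, h f' g']
  exact (hf.smul_const _).add (hg.smul_const _)

theorem dist_planePoint_sq (x z x' z' : ℝ) :
    dist (planePoint 0 x z) (planePoint 1 x' z') ^ 2 = x ^ 2 + x' ^ 2 + (z' - z) ^ 2 := by
  rw [dist_eq_norm, ← real_inner_self_eq_norm_sq, inner_sub_left, inner_sub_right,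
    inner_sub_right]
  simp only [inner_planePoint]
  simp
  ring

theorem updown_mul_self (i : Fin 2) : updown i * updown i = 1 := by
  fin_cases i <;> simp [updown]

end PlanePoint

/-! ### The whole arcs, including the straight ends. -/

section Arcs

variable {τ : Fin 2 → ℝ}

/-- The parameter on the curved part which is closest to `s`. -/
def clampU (τ : Fin 2 → ℝ) (i : Fin 2) (s : ℝ) : ℝ := max (-τ i) (min (τ i) s)

/-- The horizontal coordinate of `arcPoint`. -/
def arcX (τ : Fin 2 → ℝ) (i : Fin 2) (s : ℝ) : ℝ :=
  claspX τ i (clampU τ i s) + (s - clampU τ i s) * √(1 - τ i ^ 2)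

/-- The height of `arcPoint` over the tip. -/
def arcRise (τ : Fin 2 → ℝ) (i : Fin 2) (s : ℝ) : ℝ :=
  claspRise τ i (clampU τ i s) + (|s| - |clampU τ i s|) * τ i

theorem arcPoint_eq (τ : Fin 2 → ℝ) (i : Fin 2) (s : ℝ) :
    arcPoint τ i s = planePoint i (arcX τ i s) (tipHeight τ i + updown i * arcRise τ i s) := rfl

theorem clampU_neg (hτ : ∀ i, 0 < τ i ∧ τ i ≤ 1) (i : Fin 2) (s : ℝ) :
    clampU τ i (-s) = -clampU τ i s := by
  have h := (hτ i).1
  unfold clampU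
  rcases le_total s (τ i) with h1 | h1 <;> rcases le_total s (-τ i) with h2 | h2
  · rw [min_eq_right h1, max_eq_left h2, min_eq_left (by linarith), max_eq_right (by linarith)]
    ring
  · rw [min_eq_right h1, max_eq_right h2, min_eq_right (by linarith), max_eq_right (by linarith)]
  · linarith
  · rw [min_eq_left h1, min_eq_right (by linarith), max_eq_left (by linarith),
      max_eq_right (by linarith)]

theorem clampU_of_abs_le {i : Fin 2} {s : ℝ} (h : |s| ≤ τ i) : clampU τ i s = s := by
  rw [abs_le] at h
  rw [clampU, min_eq_right h.2, max_eq_right h.1]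

theorem clampU_of_ge (hτ : ∀ i, 0 < τ i ∧ τ i ≤ 1) {i : Fin 2} {s : ℝ} (h : τ i ≤ s) :
    clampU τ i s = τ i := by
  have := (hτ i).1
  rw [clampU, min_eq_left h, max_eq_right (by linarith)]

theorem clampU_mem (hτ : ∀ i, 0 < τ i ∧ τ i ≤ 1) (i : Fin 2) (s : ℝ) :
    clampU τ i s ∈ Icc (-τ i) (τ i) := by
  have := (hτ i).1
  exact ⟨le_max_left _ _, max_le (by linarith) (min_le_left _ _)⟩

theorem continuous_clampU (τ : Fin 2 → ℝ) (i : Fin 2) : Continuous (clampU τ i) := by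
  unfold clampU
  fun_prop

theorem arcX_neg (hτ : ∀ i, 0 < τ i ∧ τ i ≤ 1) (i : Fin 2) (s : ℝ) :
    arcX τ i (-s) = -arcX τ i s := by
  rw [arcX, clampU_neg hτ, claspX_neg, arcX]
  ring

theorem arcRise_neg (hτ : ∀ i, 0 < τ i ∧ τ i ≤ 1) (i : Fin 2) (s : ℝ) :
    arcRise τ i (-s) = arcRise τ i s := by
  rw [arcRise, clampU_neg hτ, claspRise_neg, arcRise, abs_neg, abs_neg]

theorem arcX_of_abs_le {i : Fin 2} {s : ℝ} (h : |s| ≤ τ i) : arcX τ i s = claspX τ i s := by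
  rw [arcX, clampU_of_abs_le h]
  ring

theorem arcRise_of_abs_le {i : Fin 2} {s : ℝ} (h : |s| ≤ τ i) :
    arcRise τ i s = claspRise τ i s := by
  rw [arcRise, clampU_of_abs_le h]
  ring

theorem arcX_of_ge (hτ : ∀ i, 0 < τ i ∧ τ i ≤ 1) {i : Fin 2} {s : ℝ} (h : τ i ≤ s) :
    arcX τ i s = τ i + (s - τ i) * √(1 - τ i ^ 2) := by
  rw [arcX, clampU_of_ge hτ h, claspX_self hτ]

theorem arcRise_of_ge (hτ : ∀ i, 0 < τ i ∧ τ i ≤ 1) {i : Fin 2} {s : ℝ} (h : τ i ≤ s) :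
    arcRise τ i s = claspRise τ i (τ i) + (s - τ i) * τ i := by
  have := (hτ i).1
  rw [arcRise, clampU_of_ge hτ h, abs_of_pos this, abs_of_pos (this.trans_le h)]

theorem arcX_zero (hτ : ∀ i, 0 < τ i ∧ τ i ≤ 1) (i : Fin 2) : arcX τ i 0 = 0 := by
  rw [arcX_of_abs_le (by simpa using (hτ i).1.le), claspX_zero]

theorem arcRise_zero (hτ : ∀ i, 0 < τ i ∧ τ i ≤ 1) (i : Fin 2) : arcRise τ i 0 = 0 := by
  rw [arcRise_of_abs_le (by simpa using (hτ i).1.le), claspRise_zero]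

theorem arcRise_abs (hτ : ∀ i, 0 < τ i ∧ τ i ≤ 1) (i : Fin 2) (s : ℝ) :
    arcRise τ i |s| = arcRise τ i s := by
  rcases abs_cases s with ⟨h, _⟩ | ⟨h, _⟩ <;> rw [h]
  exact arcRise_neg hτ i s

theorem continuous_arcX (hτ : ∀ i, 0 < τ i ∧ τ i ≤ 1) (i : Fin 2) : Continuous (arcX τ i) := by
  have h := continuous_clampU τ i
  have h2 : Continuous fun s => claspX τ i (clampU τ i s) :=
    (continuousOn_claspX hτ i).comp_continuous h (clampU_mem hτ i)
  unfold arcX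
  fun_prop

theorem continuous_arcRise (hτ : ∀ i, 0 < τ i ∧ τ i ≤ 1) (i : Fin 2) :
    Continuous (arcRise τ i) := by
  have h := continuous_clampU τ i
  have h2 : Continuous fun s => claspRise τ i (clampU τ i s) :=
    (continuousOn_claspRise hτ i).comp_continuous h (clampU_mem hτ i)
  unfold arcRise
  fun_prop

theorem continuous_arcPoint (hτ : ∀ i, 0 < τ i ∧ τ i ≤ 1) (i : Fin 2) :
    Continuous (arcPoint τ i) := by
  have h1 := continuous_arcX hτ i
  have h2 := continuous_arcRise hτ i
  exact continuous_planePoint i h1 (continuous_const.add (continuous_const.mul h2))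

theorem arcX_pos (hτ : ∀ i, 0 < τ i ∧ τ i ≤ 1) (i : Fin 2) {s : ℝ} (hs : 0 < s) :
    0 < arcX τ i s := by
  rcases le_total s (τ i) with h | h
  · rw [arcX_of_abs_le (by rwa [abs_of_pos hs])]
    exact claspX_pos hτ i ⟨hs, h⟩
  · rw [arcX_of_ge hτ h]
    have := (hτ i).1
    have : 0 ≤ (s - τ i) * √(1 - τ i ^ 2) := mul_nonneg (by linarith) (Real.sqrt_nonneg _)
    linarith

theorem monotoneOn_arcX (hτ : ∀ i, 0 < τ i ∧ τ i ≤ 1) (i : Fin 2) :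
    MonotoneOn (arcX τ i) (Ici 0) := by
  have h0 := (hτ i).1
  have h1 : MonotoneOn (arcX τ i) (Icc 0 (τ i)) := (monotoneOn_claspX hτ i).congr fun s hs =>
    (arcX_of_abs_le (by rw [abs_of_nonneg hs.1]; exact hs.2)).symm
  have h2 : MonotoneOn (arcX τ i) (Ici (τ i)) := fun s hs t ht hst => by
    rw [arcX_of_ge hτ hs, arcX_of_ge hτ ht]
    gcongr
  have := h1.union_right h2 (isGreatest_Icc h0.le) isLeast_Ici
  rwa [Icc_union_Ici_eq_Ici h0.le] at this

theorem strictMonoOn_arcRise (hτ : ∀ i, 0 < τ i ∧ τ i ≤ 1) (i : Fin 2) :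
    StrictMonoOn (arcRise τ i) (Ici 0) := by
  have h0 := (hτ i).1
  have h1 : StrictMonoOn (arcRise τ i) (Icc 0 (τ i)) :=
    (strictMonoOn_claspRise hτ i).congr fun s hs =>
      (arcRise_of_abs_le (by rw [abs_of_nonneg hs.1]; exact hs.2)).symm
  have h2 : StrictMonoOn (arcRise τ i) (Ici (τ i)) := fun s hs t ht hst => by
    rw [arcRise_of_ge hτ hs, arcRise_of_ge hτ ht]
    gcongr
  have := h1.union h2 (isGreatest_Icc h0.le) isLeast_Ici
  rwa [Icc_union_Ici_eq_Ici h0.le] at this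

theorem arcRise_nonneg (hτ : ∀ i, 0 < τ i ∧ τ i ≤ 1) (i : Fin 2) (s : ℝ) :
    0 ≤ arcRise τ i s := by
  rw [← arcRise_abs hτ, ← arcRise_zero hτ i]
  exact (strictMonoOn_arcRise hτ i).monotoneOn self_mem_Ici (abs_nonneg s) (abs_nonneg s)

/-- Closing up for the balanced pair `(τ 0, 0)` makes the height between the tips symmetric in the
two arcs, although its definition uses only the second. -/
theorem tipHeight_one_eq (hτ : ∀ i, 0 < τ i ∧ τ i ≤ 1) (i : Fin 2) :
    tipHeight τ 1 = √(1 - τ i ^ 2) + claspRise τ i (τ i) := by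
  fin_cases i
  · have h : Balanced τ (τ 0) 0 := ⟨(hτ 0).1.le, le_rfl, by simp [(hτ 0).1.ne']⟩
    have h2 := h.rise_add_rise_add_strutHeight hτ
    simp only [claspRise_zero, strutHeight] at h2
    norm_num at h2
    simp only [Fin.zero_eta]
    linarith
  · simp [tipHeight]

end Arcs

/-! ### Distances between the arcs are at least 1, with equality on struts. -/

section Thickness

variable {τ : Fin 2 → ℝ}

theorem dist_arcPoint_sq (τ : Fin 2 → ℝ) (s t : ℝ) :
    dist (arcPoint τ 0 s) (arcPoint τ 1 t) ^ 2 =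
      arcX τ 0 s ^ 2 + arcX τ 1 t ^ 2 + (tipHeight τ 1 - arcRise τ 1 t - arcRise τ 0 s) ^ 2 := by
  rw [arcPoint_eq, arcPoint_eq, dist_planePoint_sq]
  simp [tipHeight, updown]
  ring

theorem Balanced.dist_sq (hτ : ∀ i, 0 < τ i ∧ τ i ≤ 1) {u v : ℝ} (h : Balanced τ u v) :
    claspX τ 0 u ^ 2 + claspX τ 1 v ^ 2 +
      (tipHeight τ 1 - claspRise τ 1 v - claspRise τ 0 u) ^ 2 = 1 := by
  rw [← h.rise_add_rise_add_strutHeight hτ, ← h.sq_add_sq_add_sq hτ]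
  ring

theorem balanced_partner_one (hτ : ∀ i, 0 < τ i ∧ τ i ≤ 1) {v : ℝ} (h0 : 0 ≤ v)
    (h1 : v ≤ τ 1) : Balanced τ (partner τ 1 v) v := by
  have hv : |v| ≤ τ 1 := by rwa [abs_of_nonneg h0]
  refine ⟨(partner_mem hτ 1 hv).1, h0, ?_⟩
  have h2 := (hτ 0).1.ne'
  have h3 := (hτ 1).1.ne'
  simp only [partner, abs_of_nonneg h0, show Fin.rev (1 : Fin 2) = 0 from rfl]
  field_simp
  ring

/-- For a fixed point on the first curve, the distance to the second curve decreases up to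
the endpoint of the strut and increases from there on. -/
theorem one_le_sq_dist_curved (hτ : ∀ i, 0 < τ i ∧ τ i ≤ 1) {u v : ℝ} (hu : u ∈ Icc 0 (τ 0))
    (hv : v ∈ Icc 0 (τ 1)) :
    1 ≤ claspX τ 0 u ^ 2 + claspX τ 1 v ^ 2 +
      (tipHeight τ 1 - claspRise τ 1 v - claspRise τ 0 u) ^ 2 := by
  have hb := balanced_partner_zero hτ hu.1 hu.2
  set w := partner τ 0 u with hw
  set f : ℝ → ℝ := fun v => claspX τ 0 u ^ 2 + claspX τ 1 v ^ 2 +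
      (tipHeight τ 1 - claspRise τ 1 v - claspRise τ 0 u) ^ 2 with hf
  have hfw : f w = 1 := hb.dist_sq hτ
  have hw1 := hb.right_le hτ
  have hcont : ContinuousOn f (Icc 0 (τ 1)) := by
    have hsub : Icc 0 (τ 1) ⊆ Icc (-τ 1) (τ 1) :=
      Icc_subset_Icc_left (by linarith [(hτ 1).1])
    have h1 := (continuousOn_claspX hτ 1).mono hsub
    have h2 := (continuousOn_claspRise hτ 1).mono hsub
    fun_prop
  -- Force balance makes the derivative proportional to the strut height at `s` minus the actual
  -- height difference. By closing up this equals the difference of the rises on the first arc at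
  -- `u` and at the partner of `s`, whose sign is known from monotonicity.
  have hderiv : ∀ s ∈ Ioo 0 (τ 1), HasDerivAt f
      (2 * s * curvedSpeed τ 1 s * (claspRise τ 0 u - claspRise τ 0 (partner τ 1 s))) s := by
    intro s hs
    have hx := hasDerivAt_claspX hτ 1 hs
    have hr := hasDerivAt_claspRise hτ 1 hs
    have hbs := balanced_partner_one hτ hs.1.le hs.2.le
    refine (((hx.pow 2).const_add (claspX τ 0 u ^ 2)).add
      (((hr.const_sub (tipHeight τ 1)).sub_const (claspRise τ 0 u)).pow 2)).congr_deriv ?_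
    have e1 := hbs.claspX_one_mul_sqrt hτ
    have e2 := hbs.rise_add_rise_add_strutHeight hτ
    rw [← sqrt_mul_curvedSpeed hτ 1 hs, ← e2]
    push_cast
    simp only [pow_one]
    linear_combination (2 * curvedSpeed τ 1 s) * e1
  have hmono := (strictMonoOn_claspRise hτ 0).monotoneOn
  rcases le_total v w with hvw | hvw
  · have hanti : AntitoneOn f (Icc 0 w) := by
      refine antitoneOn_of_deriv_nonpos (convex_Icc _ _)
        (hcont.mono (Icc_subset_Icc_right hw1)) ?_ ?_ <;> rw [interior_Icc] <;> intro s hs <;>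
        have hs' : s ∈ Ioo 0 (τ 1) := ⟨hs.1, hs.2.trans_le hw1⟩
      · exact (hderiv s hs').differentiableAt.differentiableWithinAt
      · rw [(hderiv s hs').deriv]
        have h1 := (curvedSpeed_pos hτ 1 hs').le
        have hbs := balanced_partner_one hτ hs'.1.le hs'.2.le
        have h2 : u ≤ partner τ 1 s := by
          rw [← hb.partner_one hτ]
          refine partner_antitone hτ 1 ?_
          rw [abs_of_pos hs.1, abs_of_nonneg hb.nonneg_right]
          exact hs.2.le
        have h3 := hmono hu ⟨hbs.nonneg_left, hbs.left_le hτ⟩ h2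
        exact mul_nonpos_of_nonneg_of_nonpos
          (mul_nonneg (mul_nonneg two_pos.le hs.1.le) h1) (by linarith)
    rw [← hfw]
    exact hanti ⟨hv.1, hvw⟩ ⟨hb.nonneg_right, le_rfl⟩ hvw
  · have hmonof : MonotoneOn f (Icc w (τ 1)) := by
      refine monotoneOn_of_deriv_nonneg (convex_Icc _ _)
        (hcont.mono (Icc_subset_Icc_left hb.nonneg_right)) ?_ ?_ <;> rw [interior_Icc] <;>
        intro s hs <;>
        have hs' : s ∈ Ioo 0 (τ 1) := ⟨hb.nonneg_right.trans_lt hs.1, hs.2⟩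
      · exact (hderiv s hs').differentiableAt.differentiableWithinAt
      · rw [(hderiv s hs').deriv]
        have h1 := (curvedSpeed_pos hτ 1 hs').le
        have hbs := balanced_partner_one hτ hs'.1.le hs'.2.le
        have h2 : partner τ 1 s ≤ u := by
          rw [← hb.partner_one hτ]
          refine partner_antitone hτ 1 ?_
          rw [abs_of_pos hs'.1, abs_of_nonneg hb.nonneg_right]
          exact hs.1.le
        have h3 := hmono ⟨hbs.nonneg_left, hbs.left_le hτ⟩ hu h2
        exact mul_nonneg (mul_nonneg (mul_nonneg two_pos.le hs'.1.le) h1) (by linarith)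
    rw [← hfw]
    exact hmonof ⟨le_rfl, hw1⟩ ⟨hvw, hv.2⟩ hvw

/-- Moving outwards along a straight end increases the distance to the points on the other
side of the tip. -/
theorem straight_le (hτ : ∀ i, 0 < τ i ∧ τ i ≤ 1) (i : Fin 2) {s R : ℝ}
    (hR : 0 ≤ R) :
    arcX τ i (min s (τ i)) ^ 2 + (tipHeight τ 1 - arcRise τ i (min s (τ i)) - R) ^ 2 ≤
      arcX τ i s ^ 2 + (tipHeight τ 1 - arcRise τ i s - R) ^ 2 := by
  have h0 := (hτ i).1
  rcases le_total s (τ i) with h | h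
  · rw [min_eq_left h]
  -- The strut from the end of the curved part to the other tip is orthogonal to the straight end.
  -- Going `k` further thus adds only `k²` and the nonnegative cross term `2 k τ R`, where `R` is
  -- the rise of the other point over its tip.
  · rw [min_eq_right h, arcX_of_ge hτ h, arcX_of_ge hτ le_rfl, arcRise_of_ge hτ h,
      arcRise_of_ge hτ le_rfl, tipHeight_one_eq hτ i]
    have hc : √(1 - τ i ^ 2) ^ 2 = 1 - τ i ^ 2 :=
      Real.sq_sqrt (one_sub_sq_nonneg hτ i (by rw [abs_of_pos h0]))
    set C := √(1 - τ i ^ 2)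
    set k := s - τ i with hk
    have hk0 : 0 ≤ k := by linarith
    have h2 : 0 ≤ k ^ 2 + 2 * (k * τ i * R) := by positivity
    have h3 : (τ i + k * C) ^ 2 + (C + claspRise τ i (τ i) - (claspRise τ i (τ i) + k * τ i) - R) ^ 2
        = τ i ^ 2 + (C - R) ^ 2 + (k ^ 2 * (C ^ 2 + τ i ^ 2) + 2 * (k * τ i * R)) := by ring
    rw [h3, hc]
    simp only [sub_self, zero_mul, add_zero]
    nlinarith

theorem one_le_dist_arcPoint (hτ : ∀ i, 0 < τ i ∧ τ i ≤ 1) (s t : ℝ) :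
    1 ≤ dist (arcPoint τ 0 s) (arcPoint τ 1 t) := by
  have key : 1 ≤ dist (arcPoint τ 0 s) (arcPoint τ 1 t) ^ 2 := by
    rw [dist_arcPoint_sq]
    have hX : ∀ (i : Fin 2) (r : ℝ), arcX τ i r ^ 2 = arcX τ i |r| ^ 2 := by
      intro i r
      rcases abs_cases r with ⟨h, _⟩ | ⟨h, _⟩ <;> rw [h]
      rw [arcX_neg hτ, neg_sq]
    rw [hX 0 s, hX 1 t, ← arcRise_abs hτ 0 s, ← arcRise_abs hτ 1 t]
    -- By symmetry both parameters may be taken nonnegative. The second point is then retracted to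
    -- the curved part with the first fixed, and afterwards the first.
    have h1 := straight_le hτ 1 (s := |t|) (arcRise_nonneg hτ 0 |s|)
    have h0 := straight_le hτ 0 (s := |s|) (arcRise_nonneg hτ 1 (min |t| (τ 1)))
    have hs0 : 0 ≤ min |s| (τ 0) := le_min (abs_nonneg s) (hτ 0).1.le
    have ht0 : 0 ≤ min |t| (τ 1) := le_min (abs_nonneg t) (hτ 1).1.le
    have hc := one_le_sq_dist_curved hτ ⟨hs0, min_le_right |s| (τ 0)⟩
      ⟨ht0, min_le_right |t| (τ 1)⟩
    have hs1 : |min |s| (τ 0)| ≤ τ 0 := by rw [abs_of_nonneg hs0]; exact min_le_right _ _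
    have ht1 : |min |t| (τ 1)| ≤ τ 1 := by rw [abs_of_nonneg ht0]; exact min_le_right _ _
    rw [← arcX_of_abs_le hs1, ← arcX_of_abs_le ht1, ← arcRise_of_abs_le hs1,
      ← arcRise_of_abs_le ht1] at hc
    have e1 : tipHeight τ 1 - arcRise τ 1 (min |t| (τ 1)) - arcRise τ 0 |s| =
      tipHeight τ 1 - arcRise τ 0 |s| - arcRise τ 1 (min |t| (τ 1)) := by ring
    have e2 : tipHeight τ 1 - arcRise τ 1 (min |t| (τ 1)) - arcRise τ 0 (min |s| (τ 0)) =
      tipHeight τ 1 - arcRise τ 0 (min |s| (τ 0)) - arcRise τ 1 (min |t| (τ 1)) := by ring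
    rw [e1] at h1
    rw [e2] at hc
    linarith
  nlinarith [dist_nonneg (x := arcPoint τ 0 s) (y := arcPoint τ 1 t)]

theorem dist_arcPoint_eq_one (hτ : ∀ i, 0 < τ i ∧ τ i ≤ 1) {u v : ℝ}
    (h : |u| / τ 0 + |v| / τ 1 = 1) : dist (arcPoint τ 0 u) (arcPoint τ 1 v) = 1 := by
  have hb : Balanced τ |u| |v| := ⟨abs_nonneg u, abs_nonneg v, h⟩
  have hX : ∀ (i : Fin 2) (r : ℝ), claspX τ i r ^ 2 = claspX τ i |r| ^ 2 := by
    intro i r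
    rcases abs_cases r with ⟨h, _⟩ | ⟨h, _⟩ <;> rw [h]
    rw [claspX_neg, neg_sq]
  have h2 : dist (arcPoint τ 0 u) (arcPoint τ 1 v) ^ 2 = 1 := by
    rw [dist_arcPoint_sq, arcX_of_abs_le (hb.left_le hτ), arcX_of_abs_le (hb.right_le hτ), hX 0,
      hX 1, ← arcRise_abs hτ 0, ← arcRise_abs hτ 1, arcRise_of_abs_le (hb.abs_left_le hτ),
      arcRise_of_abs_le (hb.abs_right_le hτ), hb.dist_sq hτ]
  exact (pow_eq_one_iff_of_nonneg dist_nonneg two_ne_zero).1 h2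

end Thickness

/-! ### Position of the arcs relative to the bounding planes. -/

section Levels

variable {τ c : Fin 2 → ℝ}

theorem norm_normal (hτ : ∀ i, 0 < τ i ∧ τ i ≤ 1) (i : Fin 2) (b : Bool) :
    ‖normal τ i b‖ = 1 := by
  have h : ‖normal τ i b‖ ^ 2 = 1 := by
    rw [normal, norm_sq_planePoint, mul_pow, mul_pow,
      Real.sq_sqrt (one_sub_sq_nonneg hτ i (by rw [abs_of_pos (hτ i).1])), sq (updown i),
      updown_mul_self]
    cases b <;> simp
  exact (pow_eq_one_iff_of_nonneg (norm_nonneg _) two_ne_zero).1 h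

theorem inner_normal_arcPoint_self (τ : Fin 2 → ℝ) (i : Fin 2) (b : Bool) (s : ℝ) :
    inner ℝ (normal τ i b) (arcPoint τ i s) =
      (if b then 1 else -1) * √(1 - τ i ^ 2) * arcX τ i s +
        τ i * (updown i * tipHeight τ i + arcRise τ i s) := by
  rw [normal, arcPoint_eq, inner_planePoint, if_pos rfl]
  linear_combination (τ i * arcRise τ i s) * updown_mul_self i

theorem inner_normal_planePoint_of_ne {i j : Fin 2} (hij : j ≠ i) (b : Bool) (x z : ℝ) :
    inner ℝ (normal τ j b) (planePoint i x z) = updown j * τ j * z := by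
  rw [normal, inner_planePoint, if_neg hij, zero_add]

/-- The strut from the end of the curved part to the tip of the other arc is orthogonal to the
plane's normal, so this level is that of the other tip. Room for the curved part thus also puts the
other tip inside the region. -/
theorem bendLevel_eq (hτ : ∀ i, 0 < τ i ∧ τ i ≤ 1) (i : Fin 2) :
    bendLevel τ i = if i = 0 then τ 0 * tipHeight τ 1 else 0 := by
  rw [bendLevel, inner_normal_arcPoint_self, arcX_of_ge hτ le_rfl, arcRise_of_ge hτ le_rfl]
  have h := tipHeight_one_eq hτ i
  fin_cases i
  · simp only [Fin.zero_eta, if_true, updown] at *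
    rw [h]
    simp only [tipHeight, if_true]
    ring
  · simp only [Fin.mk_one, updown] at *
    rw [h]
    simp
    ring

/-- Half the length of the parameter interval of the `i`th arc. -/
def halfLength (τ c : Fin 2 → ℝ) (i : Fin 2) : ℝ := τ i + (c i - bendLevel τ i)

theorem lt_halfLength (hc : ∀ i, bendLevel τ i < c i) (i : Fin 2) :
    τ i < halfLength τ c i := by
  unfold halfLength
  linarith [hc i]

theorem inner_normal_arcPoint_of_ge (hτ : ∀ i, 0 < τ i ∧ τ i ≤ 1) (i : Fin 2) {s : ℝ}
    (hs : τ i ≤ s) : inner ℝ (normal τ i true) (arcPoint τ i s) = bendLevel τ i + (s - τ i) := by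
  rw [bendLevel, inner_normal_arcPoint_self, inner_normal_arcPoint_self, arcX_of_ge hτ hs,
    arcX_of_ge hτ le_rfl, arcRise_of_ge hτ hs, arcRise_of_ge hτ le_rfl]
  have hcs : √(1 - τ i ^ 2) ^ 2 = 1 - τ i ^ 2 :=
    Real.sq_sqrt (one_sub_sq_nonneg hτ i (by rw [abs_of_pos (hτ i).1]))
  simp only [if_true]
  linear_combination (s - τ i) * hcs

theorem inner_normal_arcPoint_end (hτ : ∀ i, 0 < τ i ∧ τ i ≤ 1)
    (hc : ∀ i, bendLevel τ i < c i) (i : Fin 2) (b : Bool) :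
    inner ℝ (normal τ i b) (arcPoint τ i ((if b then 1 else -1) * halfLength τ c i)) = c i := by
  have h : inner ℝ (normal τ i b) (arcPoint τ i ((if b then 1 else -1) * halfLength τ c i)) =
      inner ℝ (normal τ i true) (arcPoint τ i (halfLength τ c i)) := by
    rw [inner_normal_arcPoint_self, inner_normal_arcPoint_self]
    cases b
    · simp [arcX_neg hτ, arcRise_neg hτ]
    · simp
  rw [h, inner_normal_arcPoint_of_ge hτ i (lt_halfLength hc i).le, halfLength]
  ring

/-- The arcs stay within the region bounded by the planes. -/
theorem inner_normal_arcPoint_le (hτ : ∀ i, 0 < τ i ∧ τ i ≤ 1)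
    (hc : ∀ i, bendLevel τ i < c i) (j i : Fin 2) (b : Bool) {s : ℝ}
    (hs : |s| ≤ halfLength τ c i) : inner ℝ (normal τ j b) (arcPoint τ i s) ≤ c j := by
  rcases eq_or_ne j i with rfl | hij
  · rw [← inner_normal_arcPoint_end hτ hc j true]
    have h0 : (0 : ℝ) ≤ halfLength τ c j := (abs_nonneg s).trans hs
    simp only [if_true, one_mul]
    rw [inner_normal_arcPoint_self, inner_normal_arcPoint_self, ← arcRise_abs hτ j s]
    have hX := monotoneOn_arcX hτ j (abs_nonneg s) h0 hs
    have hR := (strictMonoOn_arcRise hτ j).monotoneOn (abs_nonneg s) h0 hs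
    have hsgn : (if b then 1 else -1) * arcX τ j s ≤ arcX τ j |s| := by
      have h1 : |arcX τ j s| = arcX τ j |s| := by
        have hn : 0 ≤ arcX τ j |s| := by
          rw [← arcX_zero hτ j]
          exact monotoneOn_arcX hτ j self_mem_Ici (abs_nonneg s) (abs_nonneg s)
        rcases abs_cases s with ⟨h, _⟩ | ⟨h, _⟩ <;> rw [h] at hn ⊢
        · exact abs_of_nonneg hn
        · rw [arcX_neg hτ] at hn ⊢
          rw [← abs_neg, abs_of_nonneg hn]
      rw [← h1]
      cases b
      · simpa using neg_le_abs _
      · simpa using le_abs_self _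
    have h2 := (hτ j).1
    have h3 := Real.sqrt_nonneg (1 - τ j ^ 2)
    have h4 := mul_le_mul_of_nonneg_left (hsgn.trans hX) h3
    have h5 := mul_le_mul_of_nonneg_left hR h2.le
    simp only [if_true, one_mul]
    nlinarith
  -- The other arc has its highest level at its tip, where the level is `bendLevel τ j`.
  · rw [arcPoint_eq, inner_normal_planePoint_of_ne hij]
    have hR := arcRise_nonneg hτ i s
    have hcj := hc j
    rw [bendLevel_eq hτ] at hcj
    have hp := mul_nonneg (hτ j).1.le hR
    fin_cases j <;> fin_cases i <;> simp_all [updown, tipHeight] <;> nlinarith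

theorem claspConfig_eq (τ c : Fin 2 → ℝ) (i : Fin 2) (t : I) :
    claspConfig τ c i t = arcPoint τ i ((2 * (t : ℝ) - 1) * halfLength τ c i) := rfl

/-- The parameter in the unit interval of the point `arcPoint τ i s`. -/
def unitParam (τ c : Fin 2 → ℝ) (i : Fin 2) (s : ℝ) : I :=
  projIcc 0 1 zero_le_one ((1 + s / halfLength τ c i) / 2)

theorem claspConfig_unitParam (hτ : ∀ i, 0 < τ i ∧ τ i ≤ 1) (hc : ∀ i, bendLevel τ i < c i)
    {i : Fin 2} {s : ℝ} (hs : |s| ≤ halfLength τ c i) :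
    claspConfig τ c i (unitParam τ c i s) = arcPoint τ i s := by
  have h0 : 0 < halfLength τ c i := (hτ i).1.trans (lt_halfLength hc i)
  have h1 : -1 ≤ s / halfLength τ c i ∧ s / halfLength τ c i ≤ 1 := by
    rw [← abs_le, abs_div, abs_of_pos h0]
    exact (div_le_one h0).2 hs
  rw [claspConfig_eq, unitParam, projIcc_of_mem zero_le_one ⟨by linarith, by linarith⟩]
  congr 1
  field_simp
  ring

theorem one_le_dist_claspConfig (hτ : ∀ i, 0 < τ i ∧ τ i ≤ 1) (c : Fin 2 → ℝ) (s t : I) :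
    1 ≤ dist (claspConfig τ c 0 s) (claspConfig τ c 1 t) := one_le_dist_arcPoint hτ _ _

theorem gThi_eq_iInf (L : Fin 2 → I → E3) :
    gThi L = ⨅ q : I × I, dist (L 0 q.1) (L 1 q.2) := by
  unfold gThi iInf
  congr 1
  ext d
  simp only [mem_ofPred_eq, mem_range, Prod.exists]
  constructor
  · rintro ⟨i, j, hij, s, t, rfl⟩
    fin_cases i <;> fin_cases j
    · exact absurd rfl hij
    · exact ⟨s, t, rfl⟩
    · exact ⟨t, s, dist_comm _ _⟩
    · exact absurd rfl hij
  · rintro ⟨s, t, rfl⟩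
    exact ⟨0, 1, by decide, s, t, rfl⟩

theorem dist_unitParam_eq_one (hτ : ∀ i, 0 < τ i ∧ τ i ≤ 1) (hc : ∀ i, bendLevel τ i < c i)
    {u v : ℝ} (h : |u| / τ 0 + |v| / τ 1 = 1) :
    dist (claspConfig τ c 0 (unitParam τ c 0 u)) (claspConfig τ c 1 (unitParam τ c 1 v)) = 1 := by
  have hb : Balanced τ |u| |v| := ⟨abs_nonneg u, abs_nonneg v, h⟩
  rw [claspConfig_unitParam hτ hc ((hb.left_le hτ).trans (lt_halfLength hc 0).le),
    claspConfig_unitParam hτ hc ((hb.right_le hτ).trans (lt_halfLength hc 1).le),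
    dist_arcPoint_eq_one hτ h]

theorem gThi_claspConfig (hτ : ∀ i, 0 < τ i ∧ τ i ≤ 1) (hc : ∀ i, bendLevel τ i < c i) :
    gThi (claspConfig τ c) = 1 := by
  rw [gThi_eq_iInf]
  refine le_antisymm ?_ (le_ciInf fun q => one_le_dist_claspConfig hτ c q.1 q.2)
  rw [← dist_unitParam_eq_one hτ hc (u := τ 0) (v := 0) (by
    simp [abs_of_pos (hτ 0).1, (hτ 0).1.ne'])]
  exact ciInf_le ⟨1, by rintro _ ⟨q, rfl⟩; exact one_le_dist_claspConfig hτ c q.1 q.2⟩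
    (unitParam τ c 0 (τ 0), unitParam τ c 1 0)

end Levels

/-! ### Straight-line isotopy to the hooks. -/

section Isotopy

variable {τ c : Fin 2 → ℝ}

theorem obstacle_contDiff (τ c : Fin 2 → ℝ) (k : Fin 2 × Bool) :
    ContDiff ℝ 1 ((claspConstraints τ c).obstacle k) := by
  show ContDiff ℝ 1 fun p => c k.1 - inner ℝ (normal τ k.1 k.2) p
  exact contDiff_const.sub (contDiff_const.inner ℝ contDiff_id)

theorem fderiv_obstacle_ne_zero (hτ : ∀ i, 0 < τ i ∧ τ i ≤ 1) (c : Fin 2 → ℝ)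
    (k : Fin 2 × Bool) (p : E3) : fderiv ℝ ((claspConstraints τ c).obstacle k) p ≠ 0 := by
  have h : HasFDerivAt ((claspConstraints τ c).obstacle k) (-innerSL ℝ (normal τ k.1 k.2)) p :=
    (innerSL ℝ (normal τ k.1 k.2)).hasFDerivAt.const_sub (c k.1)
  rw [h.fderiv]
  intro h0
  have h1 := congrArg (fun A : E3 →L[ℝ] ℝ => A (normal τ k.1 k.2)) h0
  simp only [_root_.neg_apply, innerSL_apply_apply, real_inner_self_eq_norm_sq,
    norm_normal hτ, _root_.zero_apply] at h1
  norm_num at h1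

theorem mem_endpoint_iff (hτ : ∀ i, 0 < τ i ∧ τ i ≤ 1) (c : Fin 2 → ℝ) (i : Fin 2) (b : Bool)
    (p : E3) : p ∈ (claspConstraints τ c).endpoint i b ↔ inner ℝ (normal τ i b) p = c i := by
  show p ∈ AffineSubspace.mk' (c i • normal τ i b) (ℝ ∙ normal τ i b)ᗮ ↔ _
  rw [AffineSubspace.mem_mk', Submodule.mem_orthogonal_singleton_iff_inner_right, vsub_eq_sub,
    inner_sub_right, inner_smul_right, real_inner_self_eq_norm_sq, norm_normal hτ, sub_eq_zero]
  simp

/-- The tips lie on the `z`-axis, so their difference in height is their distance. -/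
theorem one_le_tipHeight (hτ : ∀ i, 0 < τ i ∧ τ i ≤ 1) : 1 ≤ tipHeight τ 1 := by
  have h := one_le_dist_arcPoint hτ 0 0
  have h2 := dist_arcPoint_sq τ 0 0
  rw [arcX_zero hτ, arcX_zero hτ, arcRise_zero hτ, arcRise_zero hτ] at h2
  have h3 : 0 ≤ tipHeight τ 1 := by
    have h4 := arcRise_nonneg hτ 1 (τ 1)
    rw [arcRise_of_abs_le (abs_of_pos (hτ 1).1).le] at h4
    rw [tipHeight_one_eq hτ 1]
    exact add_nonneg (Real.sqrt_nonneg _) h4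
  nlinarith

/-- The hook with the same tip and the same endpoints as the `i`th arc. -/
def straightHook (τ c : Fin 2 → ℝ) (i : Fin 2) : I → E3 :=
  hookArc (arcX τ i (halfLength τ c i)) (tipHeight τ i)
    (tipHeight τ i + updown i * arcRise τ i (halfLength τ c i)) i

/-- The straight-line homotopy from the arcs to the hooks. -/
def hookHomotopy (τ c : Fin 2 → ℝ) (r : I) (i : Fin 2) (t : I) : E3 :=
  (1 - (r : ℝ)) • claspConfig τ c i t + (r : ℝ) • straightHook τ c i t

/-- The horizontal coordinate of `hookHomotopy`, as a function of `q = 2 t - 1`. -/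
def homotopyX (τ c : Fin 2 → ℝ) (i : Fin 2) (r q : ℝ) : ℝ :=
  (1 - r) * arcX τ i (q * halfLength τ c i) + r * (q * arcX τ i (halfLength τ c i))

/-- The height of `hookHomotopy` over the tip, as a function of `q = 2 t - 1`. -/
def homotopyRise (τ c : Fin 2 → ℝ) (i : Fin 2) (r q : ℝ) : ℝ :=
  (1 - r) * arcRise τ i (q * halfLength τ c i) + r * (|q| * arcRise τ i (halfLength τ c i))

theorem hookHomotopy_eq (τ c : Fin 2 → ℝ) (r : I) (i : Fin 2) (t : I) :
    hookHomotopy τ c r i t = planePoint i (homotopyX τ c i r (2 * t - 1))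
      (tipHeight τ i + updown i * homotopyRise τ c i r (2 * t - 1)) := by
  rw [hookHomotopy, claspConfig_eq, arcPoint_eq, straightHook, hookArc, smul_planePoint,
    smul_planePoint, planePoint_add, homotopyX, homotopyRise]
  congr 1
  ring

theorem halfLength_pos (hτ : ∀ i, 0 < τ i ∧ τ i ≤ 1) (hc : ∀ i, bendLevel τ i < c i)
    (i : Fin 2) : 0 < halfLength τ c i := (hτ i).1.trans (lt_halfLength hc i)

theorem homotopyX_neg (hτ : ∀ i, 0 < τ i ∧ τ i ≤ 1) (c : Fin 2 → ℝ) (i : Fin 2) (r q : ℝ) :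
    homotopyX τ c i r (-q) = -homotopyX τ c i r q := by
  rw [homotopyX, neg_mul, arcX_neg hτ, homotopyX]
  ring

theorem homotopyX_pos (hτ : ∀ i, 0 < τ i ∧ τ i ≤ 1) (hc : ∀ i, bendLevel τ i < c i)
    (i : Fin 2) (r : I) {q : ℝ} (hq : 0 < q) : 0 < homotopyX τ c i r q := by
  have h1 := halfLength_pos hτ hc i
  have h2 := arcX_pos hτ i h1
  have h3 := arcX_pos hτ i (mul_pos hq h1)
  have h4 := mul_pos hq h2
  have h5 := r.2.1
  have h6 := r.2.2
  unfold homotopyX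
  rcases h5.eq_or_lt with h | h
  · rw [← h]; linarith
  · have := mul_pos h h4
    have := mul_nonneg (sub_nonneg.2 h6) h3.le
    linarith

theorem eq_zero_of_homotopyX_eq_zero (hτ : ∀ i, 0 < τ i ∧ τ i ≤ 1)
    (hc : ∀ i, bendLevel τ i < c i) (i : Fin 2) (r : I) {q : ℝ} (h : homotopyX τ c i r q = 0) :
    q = 0 := by
  rcases lt_trichotomy q 0 with hq | hq | hq
  · have := homotopyX_pos hτ hc i r (neg_pos.2 hq)
    rw [homotopyX_neg hτ] at this
    linarith
  · exact hq
  · exact absurd h (homotopyX_pos hτ hc i r hq).ne'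

theorem homotopyRise_lt (hτ : ∀ i, 0 < τ i ∧ τ i ≤ 1) (hc : ∀ i, bendLevel τ i < c i)
    (i : Fin 2) (r : I) {p q : ℝ} (hpq : |p| < |q|) :
    homotopyRise τ c i r p < homotopyRise τ c i r q := by
  have h1 := halfLength_pos hτ hc i
  have hmono := strictMonoOn_arcRise hτ i
  have h2 : arcRise τ i (p * halfLength τ c i) < arcRise τ i (q * halfLength τ c i) := by
    rw [← arcRise_abs hτ, ← arcRise_abs hτ i (q * _)]
    refine hmono (mem_Ici.2 (abs_nonneg _)) (mem_Ici.2 (abs_nonneg _)) ?_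
    rw [abs_mul, abs_mul, abs_of_pos h1]
    exact mul_lt_mul_of_pos_right hpq h1
  have h3 : 0 < arcRise τ i (halfLength τ c i) := by
    rw [← arcRise_zero hτ i]
    exact hmono self_mem_Ici h1.le h1
  have h4 := mul_lt_mul_of_pos_right hpq h3
  have h5 := r.2.1
  have h6 := r.2.2
  unfold homotopyRise
  rcases h5.eq_or_lt with h | h
  · rw [← h]; linarith
  · have := mul_lt_mul_of_pos_left h4 h
    have := mul_le_mul_of_nonneg_left h2.le (sub_nonneg.2 h6)
    linarith

/-- Equal heights force parameters `q` equal up to sign, and the horizontal coordinate, odd and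
nonzero off the tip, tells the sign. -/
theorem injective_hookHomotopy (hτ : ∀ i, 0 < τ i ∧ τ i ≤ 1) (hc : ∀ i, bendLevel τ i < c i)
    (r : I) (i : Fin 2) : Function.Injective (hookHomotopy τ c r i) := by
  intro s t hst
  rw [hookHomotopy_eq, hookHomotopy_eq] at hst
  obtain ⟨hx, hz⟩ := planePoint_inj hst
  have hz' : homotopyRise τ c i r (2 * s - 1) = homotopyRise τ c i r (2 * t - 1) := by
    have h := updown_mul_self i
    linear_combination (updown i) * hz - (homotopyRise τ c i r (2 * s - 1) -
      homotopyRise τ c i r (2 * t - 1)) * h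
  have habs : |2 * (s : ℝ) - 1| = |2 * (t : ℝ) - 1| := by
    rcases lt_trichotomy |2 * (s : ℝ) - 1| |2 * (t : ℝ) - 1| with h | h | h
    · exact absurd hz' (homotopyRise_lt hτ hc i r h).ne
    · exact h
    · exact absurd hz' (homotopyRise_lt hτ hc i r h).ne'
  rcases abs_eq_abs.1 habs with h | h
  · exact Subtype.ext (by linarith)
  · rw [h, homotopyX_neg hτ] at hx
    have h0 := eq_zero_of_homotopyX_eq_zero hτ hc i r (q := 2 * t - 1) (by linarith)
    exact Subtype.ext (by linarith)

theorem continuous_hookHomotopy (hτ : ∀ i, 0 < τ i ∧ τ i ≤ 1) (c : Fin 2 → ℝ) (i : Fin 2) :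
    Continuous fun q : I × I => hookHomotopy τ c q.1 i q.2 := by
  simp only [hookHomotopy_eq]
  have h1 := continuous_arcX hτ i
  have h2 := continuous_arcRise hτ i
  unfold homotopyX homotopyRise
  exact continuous_planePoint i (by fun_prop) (by fun_prop)

theorem hookHomotopy_end (hτ : ∀ i, 0 < τ i ∧ τ i ≤ 1) (c : Fin 2 → ℝ) (r : I) (i : Fin 2)
    (b : Bool) : hookHomotopy τ c r i (if b then 1 else 0) =
      arcPoint τ i ((if b then 1 else -1) * halfLength τ c i) := by
  rw [hookHomotopy_eq, arcPoint_eq]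
  cases b
  · norm_num [homotopyX, homotopyRise, arcX_neg hτ, arcRise_neg hτ]
    congr 1 <;> ring
  · norm_num [homotopyX, homotopyRise]
    congr 1 <;> ring

/-- Points of a hook are convex combinations of the tip and an endpoint of the arc. -/
theorem inner_normal_straightHook_le (hτ : ∀ i, 0 < τ i ∧ τ i ≤ 1)
    (hc : ∀ i, bendLevel τ i < c i) (j i : Fin 2) (b : Bool) (t : I) :
    inner ℝ (normal τ j b) (straightHook τ c i t) ≤ c j := by
  have hl := halfLength_pos hτ hc i
  set q : ℝ := 2 * t - 1 with hq
  have hq1 : |q| ≤ 1 := abs_le.2 ⟨by linarith [t.2.1], by linarith [t.2.2]⟩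
  obtain ⟨e, he, heq⟩ : ∃ e : ℝ, |e| = halfLength τ c i ∧
      straightHook τ c i t = (1 - |q|) • arcPoint τ i 0 + |q| • arcPoint τ i e := by
    rcases abs_cases q with ⟨h, _⟩ | ⟨h, _⟩
    · refine ⟨halfLength τ c i, abs_of_pos hl, ?_⟩
      rw [straightHook, hookArc, arcPoint_eq, arcPoint_eq, smul_planePoint, smul_planePoint,
        planePoint_add, arcX_zero hτ, arcRise_zero hτ, ← hq, h]
      congr 1 <;> ring
    · refine ⟨-halfLength τ c i, by rw [abs_neg, abs_of_pos hl], ?_⟩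
      rw [straightHook, hookArc, arcPoint_eq, arcPoint_eq, smul_planePoint, smul_planePoint,
        planePoint_add, arcX_zero hτ, arcRise_zero hτ, arcX_neg hτ, arcRise_neg hτ, ← hq, h]
      congr 1 <;> ring
  rw [heq, inner_add_right, inner_smul_right, inner_smul_right]
  have h1 := inner_normal_arcPoint_le hτ hc j i b (s := 0) (by simpa using hl.le)
  have h2 := inner_normal_arcPoint_le hτ hc j i b he.le
  have h3 := mul_le_mul_of_nonneg_left h1 (sub_nonneg.2 hq1)
  have h4 := mul_le_mul_of_nonneg_left h2 (abs_nonneg q)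
  linarith

theorem abs_param_le (hτ : ∀ i, 0 < τ i ∧ τ i ≤ 1) (hc : ∀ i, bendLevel τ i < c i) (i : Fin 2)
    (t : I) : |(2 * (t : ℝ) - 1) * halfLength τ c i| ≤ halfLength τ c i := by
  have hl := halfLength_pos hτ hc i
  rw [abs_mul, abs_of_pos hl]
  exact mul_le_of_le_one_left hl.le (abs_le.2 ⟨by linarith [t.2.1], by linarith [t.2.2]⟩)

/-- Arcs in perpendicular planes can meet only on the `z`-axis, which each touches only at its fixed
tip. Endpoints do not move, and the region is convex. -/
theorem isGeneralizedLink_hookHomotopy (hτ : ∀ i, 0 < τ i ∧ τ i ≤ 1)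
    (hc : ∀ i, bendLevel τ i < c i) (r : I) :
    IsGeneralizedLink (claspConstraints τ c) (hookHomotopy τ c r) where
  obstacle_contDiff := obstacle_contDiff τ c
  obstacle_regular k p _ := fderiv_obstacle_ne_zero hτ c k p
  continuous i := (continuous_hookHomotopy hτ c i).comp (by fun_prop : Continuous fun t => (r, t))
  disjoint i j hij s t h := by
    rw [hookHomotopy_eq, hookHomotopy_eq] at h
    obtain ⟨hi, hj, hz⟩ := planePoint_eq_planePoint_of_ne hij h
    have hR : ∀ k, homotopyRise τ c k r 0 = 0 := fun k => by
      simp [homotopyRise, arcRise_zero hτ]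
    rw [eq_zero_of_homotopyX_eq_zero hτ hc i r hi, eq_zero_of_homotopyX_eq_zero hτ hc j r hj,
      hR, hR] at hz
    have h1 := one_le_tipHeight hτ
    have h0 : tipHeight τ 0 = 0 := by simp [tipHeight]
    fin_cases i <;> fin_cases j <;> simp_all <;> linarith
  start_mem i := by
    rw [mem_endpoint_iff hτ, ← inner_normal_arcPoint_end hτ hc i false,
      ← hookHomotopy_end hτ c r i false]
    rfl
  end_mem i := by
    rw [mem_endpoint_iff hτ, ← inner_normal_arcPoint_end hτ hc i true,
      ← hookHomotopy_end hτ c r i true]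
    rfl
  avoids k i t := by
    show 0 ≤ c k.1 - inner ℝ (normal τ k.1 k.2) (hookHomotopy τ c r i t)
    rw [hookHomotopy, inner_add_right, inner_smul_right, inner_smul_right]
    have h1 := inner_normal_arcPoint_le hτ hc k.1 i k.2 (abs_param_le hτ hc i t)
    rw [← claspConfig_eq] at h1
    have h2 := inner_normal_straightHook_le hτ hc k.1 i k.2 t
    have h3 := mul_le_mul_of_nonneg_left h1 (sub_nonneg.2 r.2.2)
    have h4 := mul_le_mul_of_nonneg_left h2 r.2.1
    linarith

theorem hookHomotopy_zero (τ c : Fin 2 → ℝ) : hookHomotopy τ c 0 = claspConfig τ c := by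
  funext i t
  simp [hookHomotopy]

theorem isGeneralizedLink_claspConfig (hτ : ∀ i, 0 < τ i ∧ τ i ≤ 1)
    (hc : ∀ i, bendLevel τ i < c i) :
    IsGeneralizedLink (claspConstraints τ c) (claspConfig τ c) := by
  rw [← hookHomotopy_zero]
  exact isGeneralizedLink_hookHomotopy hτ hc 0

theorem inClaspClass_claspConfig (hτ : ∀ i, 0 < τ i ∧ τ i ≤ 1)
    (hc : ∀ i, bendLevel τ i < c i) : InClaspClass τ c (claspConfig τ c) := by
  have h1 := one_le_tipHeight hτ
  refine ⟨fun i => arcX τ i (halfLength τ c i), tipHeight τ,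
    fun i => tipHeight τ i + updown i * arcRise τ i (halfLength τ c i),
    fun i => arcX_pos hτ i (halfLength_pos hτ hc i), ?_, fun i j b => ?_,
    hookHomotopy τ c, continuous_hookHomotopy hτ c, hookHomotopy_zero τ c, ?_,
    fun r => ⟨isGeneralizedLink_hookHomotopy hτ hc r, injective_hookHomotopy hτ hc r⟩⟩
  · have h0 : tipHeight τ 0 = 0 := by simp [tipHeight]
    linarith
  · have hb := hc j
    have ht := (hτ j).1
    rw [bendLevel_eq hτ] at hb
    rw [normal, inner_planePoint, mul_zero, ite_self, zero_add]
    have h0 : tipHeight τ 0 = 0 := by simp [tipHeight]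
    fin_cases j <;> fin_cases i <;> simp [updown, h0] at * <;> nlinarith
  · funext i t
    simp [hookHomotopy, straightHook]

end Isotopy

/-! ### Unit tangent, speed and curvature density. -/

section Tangent

variable {τ c : Fin 2 → ℝ}

/-- The unit tangent of the `i`th clasp curve. -/
def tangent (τ : Fin 2 → ℝ) (i : Fin 2) (s : ℝ) : E3 :=
  planePoint i √(1 - clampU τ i s ^ 2) (updown i * clampU τ i s)

/-- The speed of the `i`th clasp curve. -/
def speed (τ : Fin 2 → ℝ) (i : Fin 2) (s : ℝ) : ℝ :=
  if |s| < τ i then curvedSpeed τ i |s| else 1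

/-- The derivative of the unit tangent of the `i`th clasp curve, its curvature density. -/
def bend (τ : Fin 2 → ℝ) (i : Fin 2) (s : ℝ) : E3 :=
  if |s| < τ i then planePoint i (-s / √(1 - s ^ 2)) (updown i) else 0

theorem continuous_tangent (τ : Fin 2 → ℝ) (i : Fin 2) : Continuous (tangent τ i) := by
  have h := continuous_clampU τ i
  exact continuous_planePoint i (by fun_prop) (by fun_prop)

theorem norm_tangent (hτ : ∀ i, 0 < τ i ∧ τ i ≤ 1) (i : Fin 2) (s : ℝ) :
    ‖tangent τ i s‖ = 1 := by
  have h : ‖tangent τ i s‖ ^ 2 = 1 := by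
    rw [tangent, norm_sq_planePoint, mul_pow,
      Real.sq_sqrt (one_sub_sq_nonneg hτ i (abs_le.2 (clampU_mem hτ i s))), sq (updown i),
      updown_mul_self]
    ring
  exact (pow_eq_one_iff_of_nonneg (norm_nonneg _) two_ne_zero).1 h

/-- The tip is excluded because the formula for `slopeX` reads `0 / 0 = 0` there. -/
theorem speed_pos (hτ : ∀ i, 0 < τ i ∧ τ i ≤ 1) (i : Fin 2) {s : ℝ} (hs : s ≠ 0) :
    0 < speed τ i s := by
  unfold speed
  split_ifs with h
  · exact curvedSpeed_pos hτ i ⟨abs_pos.2 hs, h⟩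
  · exact one_pos

theorem speed_neg (τ : Fin 2 → ℝ) (i : Fin 2) (s : ℝ) : speed τ i (-s) = speed τ i s := by
  simp [speed]

theorem hasDerivAt_arcX_of_pos (hτ : ∀ i, 0 < τ i ∧ τ i ≤ 1) (i : Fin 2) {s : ℝ} (hs : 0 < s)
    (hs' : s ≠ τ i) : HasDerivAt (arcX τ i) (√(1 - clampU τ i s ^ 2) * speed τ i s) s := by
  rcases hs'.lt_or_gt with h | h
  · have h1 : |s| < τ i := by rwa [abs_of_pos hs]
    rw [clampU_of_abs_le h1.le, speed, if_pos h1, abs_of_pos hs,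
      sqrt_mul_curvedSpeed hτ i ⟨hs, h⟩]
    refine (hasDerivAt_claspX hτ i ⟨hs, h⟩).congr_of_eventuallyEq ?_
    filter_upwards [Ioo_mem_nhds hs h] with r hr
    exact arcX_of_abs_le (by rw [abs_of_pos hr.1]; exact hr.2.le)
  · have h1 : ¬|s| < τ i := by rw [abs_of_pos hs]; exact h.le.not_gt
    rw [clampU_of_ge hτ h.le, speed, if_neg h1, mul_one]
    have h2 : HasDerivAt (fun r => τ i + (r - τ i) * √(1 - τ i ^ 2)) (1 * √(1 - τ i ^ 2)) s :=
      (((hasDerivAt_id s).sub_const (τ i)).mul_const _).const_add _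
    rw [one_mul] at h2
    refine h2.congr_of_eventuallyEq ?_
    filter_upwards [lt_mem_nhds h] with r hr
    exact arcX_of_ge hτ hr.le

theorem hasDerivAt_arcRise_of_pos (hτ : ∀ i, 0 < τ i ∧ τ i ≤ 1) (i : Fin 2) {s : ℝ}
    (hs : 0 < s) (hs' : s ≠ τ i) :
    HasDerivAt (arcRise τ i) (clampU τ i s * speed τ i s) s := by
  rcases hs'.lt_or_gt with h | h
  · have h1 : |s| < τ i := by rwa [abs_of_pos hs]
    rw [clampU_of_abs_le h1.le, speed, if_pos h1, abs_of_pos hs]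
    refine (hasDerivAt_claspRise hτ i ⟨hs, h⟩).congr_of_eventuallyEq ?_
    filter_upwards [Ioo_mem_nhds hs h] with r hr
    exact arcRise_of_abs_le (by rw [abs_of_pos hr.1]; exact hr.2.le)
  · have h1 : ¬|s| < τ i := by rw [abs_of_pos hs]; exact h.le.not_gt
    rw [clampU_of_ge hτ h.le, speed, if_neg h1, mul_one]
    have h2 : HasDerivAt (fun r => claspRise τ i (τ i) + (r - τ i) * τ i) (1 * τ i) s :=
      (((hasDerivAt_id s).sub_const (τ i)).mul_const _).const_add _
    rw [one_mul] at h2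
    refine h2.congr_of_eventuallyEq ?_
    filter_upwards [lt_mem_nhds h] with r hr
    exact arcRise_of_ge hτ hr.le

theorem hasDerivAt_arcPoint (hτ : ∀ i, 0 < τ i ∧ τ i ≤ 1) (i : Fin 2) {s : ℝ} (h0 : s ≠ 0)
    (hs : |s| ≠ τ i) : HasDerivAt (arcPoint τ i) (speed τ i s • tangent τ i s) s := by
  have key : HasDerivAt (arcX τ i) (√(1 - clampU τ i s ^ 2) * speed τ i s) s ∧
      HasDerivAt (arcRise τ i) (clampU τ i s * speed τ i s) s := by
    rcases h0.lt_or_gt with h | h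
    · rw [abs_of_neg h] at hs
      have hX := (hasDerivAt_arcX_of_pos hτ i (neg_pos.2 h) hs).scomp s (hasDerivAt_neg s)
      have hR := (hasDerivAt_arcRise_of_pos hτ i (neg_pos.2 h) hs).scomp s (hasDerivAt_neg s)
      rw [clampU_neg hτ, speed_neg] at hX hR
      constructor
      · refine (hX.neg.congr_of_eventuallyEq (Eventually.of_forall fun r => ?_)).congr_deriv ?_
        · simp [arcX_neg hτ]
        · simp
      · refine (hR.congr_of_eventuallyEq (Eventually.of_forall fun r => ?_)).congr_deriv ?_
        · simp [arcRise_neg hτ]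
        · simp
    · rw [abs_of_pos h] at hs
      exact ⟨hasDerivAt_arcX_of_pos hτ i h hs, hasDerivAt_arcRise_of_pos hτ i h hs⟩
  refine (hasDerivAt_planePoint i key.1
    ((key.2.const_mul (updown i)).const_add (tipHeight τ i))).congr_deriv ?_
  rw [tangent, smul_planePoint]
  congr 1 <;> ring

theorem hasDerivAt_tangent (hτ : ∀ i, 0 < τ i ∧ τ i ≤ 1) (i : Fin 2) {s : ℝ}
    (hs : |s| ≠ τ i) : HasDerivAt (tangent τ i) (bend τ i s) s := by
  rcases hs.lt_or_gt with h | h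
  · rw [bend, if_pos h]
    have hpos := one_sub_sq_pos hτ i h
    have h1 := ((hasDerivAt_pow 2 s).const_sub 1).sqrt hpos.ne'
    have h2 := (hasDerivAt_id s).const_mul (updown i)
    refine ((hasDerivAt_planePoint i h1 h2).congr_of_eventuallyEq ?_).congr_deriv ?_
    · filter_upwards [continuous_abs.continuousAt.eventually_lt continuousAt_const h] with r hr
      simp only [tangent, clampU_of_abs_le hr.le, id]
    · congr 1
      · have := (Real.sqrt_pos.2 hpos).ne'
        push_cast
        field_simp
      · ring
  · rw [bend, if_neg h.le.not_gt]
    rcases le_total 0 s with h0 | h0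
    · rw [abs_of_nonneg h0] at h
      refine (hasDerivAt_const s (planePoint i √(1 - τ i ^ 2)
        (updown i * τ i))).congr_of_eventuallyEq ?_
      filter_upwards [lt_mem_nhds h] with r hr
      simp only [tangent, clampU_of_ge hτ hr.le]
    · rw [abs_of_nonpos h0] at h
      refine (hasDerivAt_const s (planePoint i √(1 - (-τ i) ^ 2)
        (updown i * -τ i))).congr_of_eventuallyEq ?_
      filter_upwards [gt_mem_nhds (show s < -τ i by linarith)] with r hr
      have e : clampU τ i r = -τ i := by
        rw [← neg_neg r, clampU_neg hτ, clampU_of_ge hτ (by linarith)]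
      simp only [tangent, e]

theorem intervalIntegrable_speed (hτ : ∀ i, 0 < τ i ∧ τ i ≤ 1) (i : Fin 2) {l : ℝ}
    (hl : τ i ≤ l) : IntervalIntegrable (speed τ i) volume (-l) l := by
  have h0 := (hτ i).1
  have h1 : IntervalIntegrable (speed τ i) volume 0 (τ i) := by
    refine (intervalIntegrable_curvedSpeed hτ i).congr_uIoo fun s hs => ?_
    rw [uIoo_of_le h0.le] at hs
    simp [speed, abs_of_pos hs.1, hs.2]
  have h2 : IntervalIntegrable (speed τ i) volume (τ i) l := by
    refine (intervalIntegrable_const (c := (1 : ℝ))).congr_uIoo fun s hs => ?_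
    rw [uIoo_of_le hl] at hs
    simp [speed, abs_of_pos (h0.trans hs.1), hs.1.le]
  have h3 := h1.trans h2
  have h4 : IntervalIntegrable (speed τ i) volume (-l) 0 := by
    have := ((IntervalIntegrable.iff_comp_neg (by finiteness)).1 h3).symm
    simpa [speed_neg] using this
  exact h4.trans h3

/-- On the curved part the density is a unit vector times `1 / √(1 - s²)`, the derivative of
`arcsin`. It is therefore integrable even if `τ i = 1`, where it is unbounded. -/
theorem intervalIntegrable_bend (hτ : ∀ i, 0 < τ i ∧ τ i ≤ 1) (i : Fin 2) {l : ℝ}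
    (hl : τ i ≤ l) : IntervalIntegrable (bend τ i) volume (-l) l := by
  have h0 := (hτ i).1
  have harcsin : IntervalIntegrable (fun s : ℝ => 1 / √(1 - s ^ 2)) volume (-τ i) (τ i) := by
    refine intervalIntegrable_deriv_of_nonneg (g := Real.arcsin)
      Real.continuous_arcsin.continuousOn ?_ fun _ _ => by positivity
    rw [min_eq_left (by linarith), max_eq_right (by linarith)]
    intro s hs
    have := hτ i
    exact Real.hasDerivAt_arcsin (by linarith [hs.1]) (by linarith [hs.2])
  have h1 : IntervalIntegrable (bend τ i) volume (-τ i) (τ i) := by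
    have hcont : Continuous fun s => planePoint i (-s) (updown i * √(1 - s ^ 2)) :=
      continuous_planePoint i (by fun_prop) (by fun_prop)
    refine (harcsin.smul_continuousOn hcont.continuousOn).congr_uIoo fun s hs => ?_
    rw [uIoo_of_le (by linarith)] at hs
    have hs' : |s| < τ i := abs_lt.2 hs
    have := (Real.sqrt_pos.2 (one_sub_sq_pos hτ i hs')).ne'
    simp only [bend, if_pos hs', smul_planePoint]
    congr 1 <;> field_simp
  have h2 : IntervalIntegrable (bend τ i) volume (τ i) l := by
    refine (intervalIntegrable_const (c := (0 : E3))).congr_uIoo fun s hs => ?_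
    rw [uIoo_of_le hl] at hs
    simp [bend, abs_of_pos (h0.trans hs.1), hs.1.le]
  have h3 : IntervalIntegrable (bend τ i) volume (-l) (-τ i) := by
    refine (intervalIntegrable_const (c := (0 : E3))).congr_uIoo fun s hs => ?_
    rw [uIoo_of_le (by linarith)] at hs
    have : ¬|s| < τ i := by rw [abs_of_neg (by linarith [hs.2])]; linarith [hs.2]
    simp [bend, this]
  exact (h3.trans h1).trans h2

end Tangent

/-! ### The curvature force of an arc. -/

section Force

variable {τ c : Fin 2 → ℝ}

theorem continuous_unitParam (τ c : Fin 2 → ℝ) (i : Fin 2) : Continuous (unitParam τ c i) := by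
  unfold unitParam
  exact continuous_projIcc.comp (by fun_prop)

theorem intervalIntegrable_inner_bend (hτ : ∀ i, 0 < τ i ∧ τ i ≤ 1)
    (hc : ∀ i, bendLevel τ i < c i) (i : Fin 2) (ξ : C(I, E3)) :
    IntervalIntegrable (fun s => inner ℝ (ξ (unitParam τ c i s)) (bend τ i s)) volume
      (-halfLength τ c i) (halfLength τ c i) :=
  intervalIntegrable_inner (ξ.continuous.comp (continuous_unitParam τ c i))
    (intervalIntegrable_bend hτ i (lt_halfLength hc i).le)

/-- The part of the curvature force along the curve. -/
def bendForce (hτ : ∀ i, 0 < τ i ∧ τ i ≤ 1) (hc : ∀ i, bendLevel τ i < c i) (i : Fin 2) :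
    C(I, E3) →L[ℝ] ℝ :=
  LinearMap.mkContinuous
    { toFun := fun ξ => ∫ s in (-halfLength τ c i)..(halfLength τ c i),
        inner ℝ (ξ (unitParam τ c i s)) (bend τ i s)
      map_add' := fun ξ η => by
        simp only [ContinuousMap.add_apply, inner_add_left]
        exact intervalIntegral.integral_add (intervalIntegrable_inner_bend hτ hc i ξ)
          (intervalIntegrable_inner_bend hτ hc i η)
      map_smul' := fun r ξ => by
        simp only [ContinuousMap.smul_apply, real_inner_smul_left, RingHom.id_apply, smul_eq_mul]
        exact intervalIntegral.integral_const_mul _ _ }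
    (∫ s in (-halfLength τ c i)..(halfLength τ c i), ‖bend τ i s‖) (fun ξ => by
      have hl := halfLength_pos hτ hc i
      have hle : -halfLength τ c i ≤ halfLength τ c i := by linarith
      simp only [LinearMap.coe_mk, AddHom.coe_mk]
      rw [← intervalIntegral.integral_mul_const]
      refine norm_integral_le_of_norm_le hle (Eventually.of_forall fun s _ => ?_)
        ((intervalIntegrable_bend hτ i (lt_halfLength hc i).le).norm.mul_const _)
      refine (norm_inner_le_norm _ _).trans ?_
      rw [mul_comm]
      gcongr
      exact ξ.norm_coe_le_norm _)

/-- The curvature force of the `i`th arc, with atoms at the endpoints. -/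
def curvatureForce (hτ : ∀ i, 0 < τ i ∧ τ i ≤ 1) (hc : ∀ i, bendLevel τ i < c i) (i : Fin 2) :
    C(I, E3) →L[ℝ] ℝ :=
  bendForce hτ hc i -
    (innerSL ℝ (tangent τ i (halfLength τ c i))).comp (ContinuousMap.evalCLM ℝ (1 : I)) +
    (innerSL ℝ (tangent τ i (-halfLength τ c i))).comp (ContinuousMap.evalCLM ℝ (0 : I))

theorem curvatureForce_apply (hτ : ∀ i, 0 < τ i ∧ τ i ≤ 1) (hc : ∀ i, bendLevel τ i < c i)
    (i : Fin 2) (ξ : C(I, E3)) : curvatureForce hτ hc i ξ =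
      (∫ s in (-halfLength τ c i)..(halfLength τ c i),
        inner ℝ (ξ (unitParam τ c i s)) (bend τ i s)) -
      inner ℝ (tangent τ i (halfLength τ c i)) (ξ 1) +
      inner ℝ (tangent τ i (-halfLength τ c i)) (ξ 0) := rfl

theorem intervalIntegrable_comp_param {E : Type*} [NormedAddCommGroup E] {f : ℝ → E} {l : ℝ}
    (hl : 0 < l) (hf : IntervalIntegrable f volume (-l) l) :
    IntervalIntegrable (fun t => f ((2 * t - 1) * l)) volume 0 1 := by
  have h1 := (hf.comp_mul_right (c := 2 * l)).comp_sub_right (1 / 2)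
  have e1 : -l / (2 * l) + 1 / 2 = 0 := by field_simp; ring
  have e2 : l / (2 * l) + 1 / 2 = 1 := by field_simp; ring
  rw [e1, e2] at h1
  refine h1.congr fun t _ => ?_
  congr 1
  ring

theorem isCurvatureForce_claspConfig (hτ : ∀ i, 0 < τ i ∧ τ i ≤ 1)
    (hc : ∀ i, bendLevel τ i < c i) (i : Fin 2) :
    IsCurvatureForce (claspConfig τ c i) (curvatureForce hτ hc i) := by
  have hl := halfLength_pos hτ hc i
  have hτl := lt_halfLength hc i
  set l := halfLength τ c i with hl_def
  set γ : ℝ → E3 := fun t => arcPoint τ i ((2 * t - 1) * l) with hγ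
  set T : ℝ → E3 := fun t => tangent τ i ((2 * t - 1) * l) with hT
  set g : ℝ → E3 := fun t => (2 * l) • speed τ i ((2 * t - 1) * l) • T t with hg
  -- The tip and the two ends of the curved part, where derivatives may fail. The fundamental
  -- theorem of calculus holds off a countable set because the arc and its tangent are continuous;
  -- hence there are no interior atoms.
  set N : Set ℝ := {t | (2 * t - 1) * l = 0 ∨ |(2 * t - 1) * l| = τ i} with hN
  have hNc : N.Countable := by
    have : N ⊆ {1 / 2, (1 + τ i / l) / 2, (1 - τ i / l) / 2} := by
      intro t ht
      have hsolve : ∀ y : ℝ, (2 * t - 1) * l = y → t = (1 + y / l) / 2 := by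
        rintro y rfl; field_simp; ring
      rcases ht with h | h
      · left; rw [hsolve _ h]; simp
      · rcases eq_or_eq_neg_of_abs_eq h with h | h
        · right; left; exact hsolve _ h
        · right; right; rw [mem_singleton_iff, hsolve _ h]; ring
    exact (Set.toFinite _).countable.mono this
  have hparam : ∀ t : ℝ, HasDerivAt (fun t : ℝ => (2 * t - 1) * l) (2 * l) t := fun t => by
    simpa using (((hasDerivAt_id t).const_mul 2).sub_const 1).mul_const l
  have hTc : Continuous T := (continuous_tangent τ i).comp (by fun_prop)
  have hgi : IntervalIntegrable g volume 0 1 :=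
    ((intervalIntegrable_comp_param hl (intervalIntegrable_speed hτ i hτl.le)).smul_continuousOn
      hTc.continuousOn).smul (2 * l)
  have hγg : ∀ s ∈ Icc (0 : ℝ) 1, ∀ t ∈ Icc (0 : ℝ) 1, γ t - γ s = ∫ x in s..t, g x := by
    intro s hs t ht
    refine (integral_eq_of_hasDerivAt_off_countable γ g hNc
      ((continuous_arcPoint hτ i).comp (by fun_prop)).continuousOn (fun x hx => ?_)
      (intervalIntegrable_of_mem_Icc hgi hs ht)).symm
    have hx' := hx.2
    simp only [hN, mem_ofPred_eq, not_or] at hx'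
    exact (hasDerivAt_arcPoint hτ i hx'.1 hx'.2).scomp x (hparam x)
  refine ⟨?_, fun ξ f hf hξ => ?_⟩
  · have hle := eVariationOn_le_integral_norm (f := γ) hgi hγg
    exact ne_top_of_le_ne_top ENNReal.ofReal_ne_top hle
  have hlen := hasDerivAt_len (γ := γ) hgi hγg hTc (fun t => norm_tangent hτ i _) (by
    filter_upwards [hNc.ae_notMem volume] with x hx _
    simp only [hN, mem_ofPred_eq, not_or] at hx
    refine ⟨2 * l * speed τ i ((2 * x - 1) * l), mul_pos (by positivity) (speed_pos hτ i hx.1), ?_⟩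
    rw [hg, mul_smul]) hf
  have hfun : (fun r : ℝ => len fun t => claspConfig τ c i t + r • ξ t) =
      fun r : ℝ => len fun t : I => γ t + r • f t := by
    funext r
    congr 1
    funext t
    rw [hξ t]
    rfl
  rw [hfun]
  refine hlen.congr_deriv ?_
  have hbi : IntervalIntegrable (fun t => bend τ i ((2 * t - 1) * l)) volume 0 1 :=
    intervalIntegrable_comp_param hl (intervalIntegrable_bend hτ i hτl.le)
  have hf'c : Continuous (deriv f) := hf.continuous_deriv le_rfl
  have i1 : IntervalIntegrable (fun t => inner ℝ (T t) (deriv f t)) volume 0 1 :=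
    (hTc.inner hf'c).intervalIntegrable _ _
  have i2 : IntervalIntegrable (fun t => inner ℝ (f t) ((2 * l) • bend τ i ((2 * t - 1) * l)))
      volume 0 1 := intervalIntegrable_inner hf.continuous (hbi.smul (2 * l))
  -- Integration by parts moves the derivative from the field to the tangent and leaves the endpoint
  -- atoms.
  have hparts := integral_eq_of_hasDerivAt_off_countable (fun t => inner ℝ (T t) (f t))
    (fun t => inner ℝ (T t) (deriv f t) + inner ℝ (f t) ((2 * l) • bend τ i ((2 * t - 1) * l)))
    (a := 0) (b := 1) hNc (hTc.inner hf.continuous).continuousOn (fun x hx => by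
      have hx' := hx.2
      simp only [hN, mem_ofPred_eq, not_or] at hx'
      have h1 : HasDerivAt T ((2 * l) • bend τ i ((2 * x - 1) * l)) x := by
        have h := HasDerivAt.scomp (g₁ := tangent τ i) x (hasDerivAt_tangent hτ i hx'.2) (hparam x)
        exact h
      have h2 := h1.inner ℝ (hf.differentiable one_ne_zero x).hasDerivAt
      refine h2.congr_deriv ?_
      rw [real_inner_comm (f x)]) (i1.add i2)
  rw [intervalIntegral.integral_add i1 i2] at hparts
  have hsubst : (∫ t in (0 : ℝ)..1, inner ℝ (f t) ((2 * l) • bend τ i ((2 * t - 1) * l))) =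
      ∫ s in (-l)..l, inner ℝ (ξ (unitParam τ c i s)) (bend τ i s) := by
    have h := intervalIntegral.smul_integral_comp_mul_sub (a := 0) (b := 1)
      (fun s => inner ℝ (ξ (unitParam τ c i s)) (bend τ i s)) (2 * l) l
    rw [show 2 * l * 0 - l = -l by ring, show 2 * l * 1 - l = l by ring] at h
    rw [← h, ← intervalIntegral.integral_smul]
    refine intervalIntegral.integral_congr fun t ht => ?_
    rw [uIcc_of_le zero_le_one] at ht
    have e : (1 + (2 * l * t - l) / l) / 2 = t := by field_simp; ring
    simp only [smul_eq_mul, inner_smul_right, hξ, unitParam, ← hl_def, e,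
      projIcc_of_mem zero_le_one ht]
    congr 3
    ring
  rw [hsubst] at hparts
  rw [curvatureForce_apply, hξ, hξ]
  simp only [hT] at hparts ⊢
  norm_num at hparts ⊢
  rw [← hl_def]
  linarith

end Force

/-! ### One-sided variations of thickness and obstacle function. -/

section OneSidedVariation

/-- Second-order expansion of the norm. -/
theorem norm_add_smul_bounds {E : Type*} [NormedAddCommGroup E] [InnerProductSpace ℝ E] {A : E}
    (hA : 1 ≤ ‖A‖) (B : E) (r : ℝ) :
    ‖A‖ + r * (inner ℝ A B / ‖A‖) ≤ ‖A + r • B‖ ∧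
      ‖A + r • B‖ ≤ ‖A‖ + r * (inner ℝ A B / ‖A‖) + ‖B‖ ^ 2 * r ^ 2 := by
  have hA0 : 0 < ‖A‖ := one_pos.trans_le hA
  have hsq : ‖A + r • B‖ ^ 2 = ‖A‖ ^ 2 + 2 * (r * inner ℝ A B) + r ^ 2 * ‖B‖ ^ 2 := by
    rw [norm_add_sq_real, inner_smul_right, norm_smul, mul_pow, Real.norm_eq_abs, sq_abs]
  have hexp : ‖A‖ + r * (inner ℝ A B / ‖A‖) = (‖A‖ ^ 2 + r * inner ℝ A B) / ‖A‖ := by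
    field_simp
  constructor
  · rw [hexp, div_le_iff₀ hA0]
    have h := real_inner_le_norm (A + r • B) A
    rw [inner_add_left, real_inner_self_eq_norm_sq, real_inner_smul_left,
      real_inner_comm A B] at h
    exact h
  -- The lower bound was Cauchy–Schwarz against `A`; this is the inequality of arithmetic and
  -- geometric means for the two norms.
  · have h1 : ‖A + r • B‖ * ‖A‖ ≤ ‖A‖ ^ 2 + r * inner ℝ A B + r ^ 2 * ‖B‖ ^ 2 / 2 := by
      nlinarith [sq_nonneg (‖A + r • B‖ - ‖A‖)]
    have h2 : r ^ 2 * ‖B‖ ^ 2 / 2 ≤ ‖B‖ ^ 2 * r ^ 2 * ‖A‖ := by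
      have : 0 ≤ ‖B‖ ^ 2 * r ^ 2 := by positivity
      nlinarith
    have h3 : ‖A + r • B‖ ≤
        (‖A‖ ^ 2 + r * inner ℝ A B + ‖B‖ ^ 2 * r ^ 2 * ‖A‖) / ‖A‖ := by
      rw [le_div_iff₀ hA0]
      linarith
    refine h3.trans (le_of_eq ?_)
    field_simp

/-- The Gehring thickness has a one-sided variation, which is at most the rate of change of the
length of every strut. -/
theorem exists_hasOneSidedVariation_gThi {L : Fin 2 → I → E3} (hL : ∀ i, Continuous (L i))
    (hThi : ∀ s t, 1 ≤ dist (L 0 s) (L 1 t)) (h1 : gThi L = 1) (ξ : Fin 2 → C(I, E3)) :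
    ∃ d, HasOneSidedVariation gThi L ξ d ∧ ∀ s t, dist (L 0 s) (L 1 t) = 1 →
      d ≤ inner ℝ (L 0 s - L 1 t) (ξ 0 s - ξ 1 t) := by
  set A : I × I → E3 := fun q => L 0 q.1 - L 1 q.2 with hA
  set B : I × I → E3 := fun q => ξ 0 q.1 - ξ 1 q.2 with hB
  have hA1 : ∀ q, 1 ≤ ‖A q‖ := fun q => by
    rw [hA, ← dist_eq_norm]; exact hThi _ _
  have hAc : Continuous A := by
    have := hL 0; have := hL 1
    fun_prop
  have hBc : Continuous B := by fun_prop
  obtain ⟨C, hC⟩ := isCompact_univ.exists_bound_of_continuousOn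
    (f := fun q => ‖B q‖ ^ 2) (by fun_prop)
  have hvary : ∀ r, gThi (vary L ξ r) = ⨅ q, ‖A q + r • B q‖ := by
    intro r
    rw [gThi_eq_iInf]
    refine iInf_congr fun q => ?_
    rw [dist_eq_norm]
    congr 1
    simp only [vary, hA, hB]
    module
  have hbdd : ∀ r : ℝ, BddBelow (range fun q => ‖A q + r • B q‖) := fun r =>
    ⟨0, by rintro _ ⟨q, rfl⟩; exact norm_nonneg _⟩
  have hbc : Continuous fun q => inner ℝ (A q) (B q) / ‖A q‖ :=
    (hAc.inner hBc).div hAc.norm fun q => (one_pos.trans_le (hA1 q)).ne'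
  have hbdd' : ∀ r : ℝ, BddBelow (range fun q => ‖A q‖ + r * (inner ℝ (A q) (B q) / ‖A q‖)) :=
    fun r => (isCompact_range (by fun_prop)).bddBelow
  obtain ⟨d, hd, hdb⟩ := exists_hasDerivWithinAt_of_affine_bounds hAc.norm hbc
    (F := fun r => gThi (vary L ξ r)) (C := C)
    (fun r _ => by
      rw [hvary]
      exact ciInf_mono (hbdd' r) fun q => (norm_add_smul_bounds (hA1 q) (B q) r).1)
    (fun r _ => by
      rw [hvary, ← sub_le_iff_le_add]
      refine le_ciInf fun q => ?_
      have h2 := ciInf_le (hbdd r) q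
      have h3 := (norm_add_smul_bounds (hA1 q) (B q) r).2
      have h4 : ‖B q‖ ^ 2 ≤ C := (le_abs_self _).trans (hC q (mem_univ q))
      have h5 := mul_le_mul_of_nonneg_right h4 (sq_nonneg r)
      linarith)
  refine ⟨d, hd, fun s t hst => ?_⟩
  have hst' : ‖A (s, t)‖ = 1 := by rw [hA, ← dist_eq_norm]; exact hst
  have h := hdb (s, t) (by
    rw [hst', ← h1, gThi_eq_iInf]
    simp only [hA, dist_eq_norm])
  rwa [hst', div_one] at h

/-- The obstacle functions are affine, so along a variation their minimum is exactly a minimum of a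
compact affine family. -/
theorem exists_hasOneSidedVariation_obstacleMin (τ c : Fin 2 → ℝ) {L : Fin 2 → I → E3}
    (hL : ∀ i, Continuous (L i)) (ξ : Fin 2 → C(I, E3)) :
    ∃ d, HasOneSidedVariation (obstacleMin (claspConstraints τ c)) L ξ d := by
  have hpair : ∀ M : Fin 2 → I → E3, (∀ i, Continuous (M i)) →
      Continuous fun q : (Fin 2 × Bool) × Fin 2 × I =>
        inner ℝ (normal τ q.1.1 q.1.2) (M q.2.1 q.2.2) := by
    intro M hM
    refine continuous_prod_of_discrete_left.2 fun k => ?_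
    refine continuous_prod_of_discrete_left.2 fun i => ?_
    exact Continuous.inner (𝕜 := ℝ) (continuous_const (y := normal τ k.1 k.2)) (hM i)
  have hcc : Continuous fun q : (Fin 2 × Bool) × Fin 2 × I => c q.1.1 :=
    continuous_prod_of_discrete_left.2 fun k => continuous_const (y := c k.1)
  obtain ⟨d, hd, -⟩ := hasDerivWithinAt_iInf_affine (hcc.sub (hpair L hL))
    (hpair (fun i => ξ i) fun i => (ξ i).continuous).neg
  refine ⟨d, hd.congr_of_eventuallyEq (Eventually.of_forall fun r => ?_) ?_⟩ <;>
  · refine iInf_congr fun q => ?_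
    simp only [claspConstraints, vary, inner_add_right, inner_smul_right, Pi.sub_apply,
      Pi.neg_apply]
    ring

end OneSidedVariation

/-! ### Balance of the struts and strong criticality. -/

section Criticality

variable {τ c : Fin 2 → ℝ}

theorem tangent_halfLength (hτ : ∀ i, 0 < τ i ∧ τ i ≤ 1) (hc : ∀ i, bendLevel τ i < c i)
    (i : Fin 2) : tangent τ i (halfLength τ c i) = normal τ i true := by
  rw [tangent, clampU_of_ge hτ (lt_halfLength hc i).le, normal]
  simp

theorem tangent_neg_halfLength (hτ : ∀ i, 0 < τ i ∧ τ i ≤ 1) (hc : ∀ i, bendLevel τ i < c i)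
    (i : Fin 2) : tangent τ i (-halfLength τ c i) = -normal τ i false := by
  rw [tangent, clampU_neg hτ, clampU_of_ge hτ (lt_halfLength hc i).le, normal,
    ← neg_one_smul ℝ (planePoint _ _ _), smul_planePoint]
  congr 1
  · simp
  · ring

theorem inner_normal_of_compatible {ξ : Fin 2 → C(I, E3)}
    (h : Compatible (claspConstraints τ c) ξ) (i : Fin 2) :
    inner ℝ (normal τ i false) (ξ i 0) = 0 ∧ inner ℝ (normal τ i true) (ξ i 1) = 0 := by
  have h1 := (h i).1
  have h2 := (h i).2
  simp only [claspConstraints, AffineSubspace.direction_mk',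
    Submodule.mem_orthogonal_singleton_iff_inner_right] at h1 h2
  exact ⟨h1, h2⟩

/-- The pairing of a field with the curvature density at the two points of the `i`th arc with
parameters `± τ i p`. -/
def bendPairing (τ c : Fin 2 → ℝ) (i : Fin 2) (ξ : C(I, E3)) (p : ℝ) : ℝ :=
  inner ℝ (ξ (unitParam τ c i (τ i * p))) (bend τ i (τ i * p)) +
    inner ℝ (ξ (unitParam τ c i (-(τ i * p)))) (bend τ i (-(τ i * p)))

theorem intervalIntegrable_bendPairing (hτ : ∀ i, 0 < τ i ∧ τ i ≤ 1)
    (hc : ∀ i, bendLevel τ i < c i) (i : Fin 2) (ξ : C(I, E3)) :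
    IntervalIntegrable (bendPairing τ c i ξ) volume 0 1 := by
  have h0 := (hτ i).1
  have hl := lt_halfLength hc i
  have h := intervalIntegrable_inner_bend hτ hc i ξ
  have hpos := h.mono_set (c := 0) (d := τ i) (by
    rw [uIcc_of_le h0.le, uIcc_of_le (by linarith)]
    exact Icc_subset_Icc (by linarith) hl.le)
  have hneg := h.mono_set (c := 0) (d := -τ i) (by
    rw [uIcc_of_ge (by linarith), uIcc_of_le (by linarith)]
    exact Icc_subset_Icc (by linarith) (by linarith))
  have h1 := hpos.comp_mul_left (c := τ i) (by finiteness) (by finiteness)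
  have h2 := hneg.comp_mul_left (c := -τ i) (by finiteness) (by finiteness)
  rw [zero_div, div_self h0.ne'] at h1
  rw [zero_div, div_self (neg_ne_zero.2 h0.ne')] at h2
  refine (h1.add h2).congr fun p _ => ?_
  simp [bendPairing]

/-- The density vanishes on the straight ends; the two halves of the curved part are folded together
and rescaled by `s = τ i * p`. The weight will cancel the factor `τ i`. -/
theorem integral_inner_bend_eq (hτ : ∀ i, 0 < τ i ∧ τ i ≤ 1) (hc : ∀ i, bendLevel τ i < c i)
    (i : Fin 2) (ξ : C(I, E3)) :
    (∫ s in (-halfLength τ c i)..(halfLength τ c i),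
      inner ℝ (ξ (unitParam τ c i s)) (bend τ i s)) =
      τ i * ∫ p in (0 : ℝ)..1, bendPairing τ c i ξ p := by
  have h0 := (hτ i).1
  have hl := lt_halfLength hc i
  set l := halfLength τ c i
  set φ : ℝ → ℝ := fun s => inner ℝ (ξ (unitParam τ c i s)) (bend τ i s) with hφ
  have h : IntervalIntegrable φ volume (-l) l := intervalIntegrable_inner_bend hτ hc i ξ
  have hsub : ∀ {a b : ℝ}, a ∈ Icc (-l) l → b ∈ Icc (-l) l →
      IntervalIntegrable φ volume a b := fun ha hb => h.mono_set (by
    rw [uIcc_of_le (by linarith : -l ≤ l)]; exact uIcc_subset_Icc ha hb)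
  have m1 : -l ∈ Icc (-l) l := ⟨le_rfl, by linarith⟩
  have m2 : l ∈ Icc (-l) l := ⟨by linarith, le_rfl⟩
  have m3 : τ i ∈ Icc (-l) l := ⟨by linarith, hl.le⟩
  have m4 : -τ i ∈ Icc (-l) l := ⟨by linarith, by linarith⟩
  have m5 : (0 : ℝ) ∈ Icc (-l) l := ⟨by linarith, by linarith⟩
  have hvan : ∀ s, τ i ≤ |s| → φ s = 0 := fun s hs => by simp [hφ, bend, hs.not_gt]
  have z1 : (∫ s in (-l)..(-τ i), φ s) = 0 := by
    refine (intervalIntegral.integral_congr fun s hs => ?_).trans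
      intervalIntegral.integral_zero
    rw [uIcc_of_le (by linarith)] at hs
    exact hvan s (by rw [abs_of_neg (by linarith [hs.2])]; linarith [hs.2])
  have z2 : (∫ s in (τ i)..l, φ s) = 0 := by
    refine (intervalIntegral.integral_congr fun s hs => ?_).trans
      intervalIntegral.integral_zero
    rw [uIcc_of_le hl.le] at hs
    exact hvan s (by rw [abs_of_pos (by linarith [hs.1])]; exact hs.1)
  have e1 : (∫ s in (-τ i)..0, φ s) = ∫ s in (0 : ℝ)..(τ i), φ (-s) := by
    rw [intervalIntegral.integral_comp_neg, neg_zero]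
  have hneg : IntervalIntegrable (fun s => φ (-s)) volume 0 (τ i) := by
    have := (IntervalIntegrable.iff_comp_neg (by finiteness)).1 (hsub m5 m4)
    simpa using this
  have hsum : (∫ s in (-l)..l, φ s) = ∫ s in (0 : ℝ)..(τ i), (φ s + φ (-s)) := by
    rw [intervalIntegral.integral_add (hsub m5 m3) hneg, ← e1,
      ← integral_add_adjacent_intervals (hsub m1 m4) (hsub m4 m2),
      ← integral_add_adjacent_intervals (hsub m4 m5) (hsub m5 m2),
      ← integral_add_adjacent_intervals (hsub m5 m3) (hsub m3 m2), z1, z2]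
    ring
  rw [hsum]
  have h2 := intervalIntegral.smul_integral_comp_mul_left (a := 0) (b := 1)
    (fun s => φ s + φ (-s)) (τ i)
  rw [mul_zero, mul_one, smul_eq_mul] at h2
  rw [← h2]
  rfl

/-- The density of the weighted first variation of length, at the strut parameter `p`. -/
def strutDensity (τ c : Fin 2 → ℝ) (ξ : Fin 2 → C(I, E3)) (p : ℝ) : ℝ :=
  -(bendPairing τ c 0 (ξ 0) p + bendPairing τ c 1 (ξ 1) (1 - p))

theorem intervalIntegrable_bendPairing_reflect (hτ : ∀ i, 0 < τ i ∧ τ i ≤ 1)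
    (hc : ∀ i, bendLevel τ i < c i) (i : Fin 2) (ξ : C(I, E3)) :
    IntervalIntegrable (fun p => bendPairing τ c i ξ (1 - p)) volume 0 1 := by
  have h := (intervalIntegrable_bendPairing hτ hc i ξ).comp_sub_left 1 (by finiteness)
  simpa using h.symm

theorem intervalIntegrable_strutDensity (hτ : ∀ i, 0 < τ i ∧ τ i ≤ 1)
    (hc : ∀ i, bendLevel τ i < c i) (ξ : Fin 2 → C(I, E3)) :
    IntervalIntegrable (strutDensity τ c ξ) volume 0 1 :=
  ((intervalIntegrable_bendPairing hτ hc 0 (ξ 0)).add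
    (intervalIntegrable_bendPairing_reflect hτ hc 1 (ξ 1))).neg

/-- The weighted first variation of length is the integral of `strutDensity`. -/
theorem weighted_variation_eq (hτ : ∀ i, 0 < τ i ∧ τ i ≤ 1) (hc : ∀ i, bendLevel τ i < c i)
    {ξ : Fin 2 → C(I, E3)} (h : Compatible (claspConstraints τ c) ξ) :
    ∑ i, 1 / τ i * -(curvatureForce hτ hc i (ξ i)) =
      ∫ p in (0 : ℝ)..1, strutDensity τ c ξ p := by
  have hK : ∀ i, 1 / τ i * -(curvatureForce hτ hc i (ξ i)) =
      -∫ p in (0 : ℝ)..1, bendPairing τ c i (ξ i) p := by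
    intro i
    have h0 := (hτ i).1.ne'
    rw [curvatureForce_apply, integral_inner_bend_eq hτ hc, tangent_halfLength hτ hc,
      tangent_neg_halfLength hτ hc, inner_neg_left, (inner_normal_of_compatible h i).1,
      (inner_normal_of_compatible h i).2]
    field_simp
    ring
  -- Reflecting `p` on the second arc aligns the points joined by struts.
  have hrefl : (∫ p in (0 : ℝ)..1, bendPairing τ c 1 (ξ 1) p) =
      ∫ p in (0 : ℝ)..1, bendPairing τ c 1 (ξ 1) (1 - p) := by
    rw [intervalIntegral.integral_comp_sub_left (fun p => bendPairing τ c 1 (ξ 1) p) 1]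
    simp
  simp only [strutDensity]
  rw [Fin.sum_univ_two, hK, hK, hrefl, intervalIntegral.integral_neg,
    intervalIntegral.integral_add (intervalIntegrable_bendPairing hτ hc 0 (ξ 0))
      (intervalIntegrable_bendPairing_reflect hτ hc 1 (ξ 1))]
  ring

theorem claspX_signed_mul_sqrt (hτ : ∀ i, 0 < τ i ∧ τ i ≤ 1) (i : Fin 2) {u H : ℝ}
    (hu : |u| < τ i) (hH : strutHeight u (partner τ i u) = H) :
    H * (-u / √(1 - u ^ 2)) = -claspX τ i u := by
  have h := claspX_mul_sqrt hτ i hu.le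
  have h1 := (Real.sqrt_pos.2 (one_sub_sq_pos hτ i hu)).ne'
  rw [hH] at h
  field_simp
  linear_combination h

theorem partner_abs (τ : Fin 2 → ℝ) (i : Fin 2) (u : ℝ) : partner τ i |u| = partner τ i u := by
  simp [partner]

theorem strutHeight_abs (u v : ℝ) : strutHeight |u| |v| = strutHeight u v := by
  simp [strutHeight]

theorem planePoint_zero_left (i j : Fin 2) (z : ℝ) : planePoint i 0 z = planePoint j 0 z := by
  fin_cases i <;> fin_cases j <;> simp [planePoint_eq]

/-- Force balance: the two struts at a point of the first curve. -/
theorem sum_struts_zero (hτ : ∀ i, 0 < τ i ∧ τ i ≤ 1) {u v : ℝ} (hb : Balanced τ |u| |v|)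
    (hu : |u| < τ 0) :
    (arcPoint τ 0 u - arcPoint τ 1 v) + (arcPoint τ 0 u - arcPoint τ 1 (-v)) =
      (-(2 * strutHeight u v)) • bend τ 0 u := by
  have hv := hb.right_le hτ
  have hclose := hb.rise_add_rise_add_strutHeight hτ
  have hp : partner τ 0 u = |v| := by rw [← partner_abs]; exact hb.partner_zero hτ
  have hx := claspX_signed_mul_sqrt hτ 0 hu (H := strutHeight u v) (by
    rw [hp, ← strutHeight_abs, abs_abs, strutHeight_abs])
  have h1 : arcPoint τ 1 v + arcPoint τ 1 (-v) =
      planePoint 0 0 (2 * (tipHeight τ 1 - arcRise τ 1 v)) := by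
    rw [arcPoint_eq, arcPoint_eq, planePoint_add, arcX_neg hτ, arcRise_neg hτ, add_neg_cancel,
      planePoint_zero_left 1 0]
    congr 1
    simp [updown]
    ring
  have h2 : (arcPoint τ 0 u - arcPoint τ 1 v) + (arcPoint τ 0 u - arcPoint τ 1 (-v)) =
      (2 : ℝ) • arcPoint τ 0 u - (arcPoint τ 1 v + arcPoint τ 1 (-v)) := by module
  rw [strutHeight_abs, ← arcRise_of_abs_le (hb.abs_left_le hτ),
    ← arcRise_of_abs_le (hb.abs_right_le hτ), arcRise_abs hτ, arcRise_abs hτ] at hclose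
  rw [h2, h1, arcPoint_eq, smul_planePoint, planePoint_sub, bend, if_pos hu, smul_planePoint,
    arcX_of_abs_le hu.le]
  congr 1
  · linear_combination 2 * hx
  · simp only [tipHeight, updown, if_true] at hclose ⊢
    linear_combination 2 * hclose

/-- Force balance: the two struts at a point of the second curve. -/
theorem sum_struts_one (hτ : ∀ i, 0 < τ i ∧ τ i ≤ 1) {u v : ℝ} (hb : Balanced τ |u| |v|)
    (hv : |v| < τ 1) :
    (arcPoint τ 0 u - arcPoint τ 1 v) + (arcPoint τ 0 (-u) - arcPoint τ 1 v) =
      (2 * strutHeight u v) • bend τ 1 v := by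
  have hu := hb.left_le hτ
  have hclose := hb.rise_add_rise_add_strutHeight hτ
  have hp : partner τ 1 v = |u| := by rw [← partner_abs]; exact hb.partner_one hτ
  have hx := claspX_signed_mul_sqrt hτ 1 hv (H := strutHeight u v) (by
    rw [hp, strutHeight_comm, ← strutHeight_abs, abs_abs, strutHeight_abs])
  have h1 : arcPoint τ 0 u + arcPoint τ 0 (-u) = planePoint 1 0 (2 * arcRise τ 0 u) := by
    rw [arcPoint_eq, arcPoint_eq, planePoint_add, arcX_neg hτ, arcRise_neg hτ, add_neg_cancel,
      planePoint_zero_left 0 1]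
    congr 1
    simp [updown, tipHeight]
    ring
  have h2 : (arcPoint τ 0 u - arcPoint τ 1 v) + (arcPoint τ 0 (-u) - arcPoint τ 1 v) =
      (arcPoint τ 0 u + arcPoint τ 0 (-u)) - (2 : ℝ) • arcPoint τ 1 v := by module
  rw [strutHeight_abs, ← arcRise_of_abs_le (hb.abs_left_le hτ),
    ← arcRise_of_abs_le (hb.abs_right_le hτ), arcRise_abs hτ, arcRise_abs hτ] at hclose
  rw [h2, h1, arcPoint_eq, smul_planePoint, planePoint_sub, bend, if_pos hv, smul_planePoint,
    arcX_of_abs_le hv.le]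
  have hud : updown 1 = -1 := by simp [updown]
  rw [hud]
  congr 1
  · linear_combination -2 * hx
  · linear_combination 2 * hclose

/-- The rate of change, to first order, of half the squared length of the segment between the
points with parameters `u` and `v`. -/
def strutRate (τ c : Fin 2 → ℝ) (ξ : Fin 2 → C(I, E3)) (u v : ℝ) : ℝ :=
  inner ℝ (arcPoint τ 0 u - arcPoint τ 1 v)
    (ξ 0 (unitParam τ c 0 u) - ξ 1 (unitParam τ c 1 v))

/-- The core of the balance: grouped by their four endpoints, the struts of a level add up to
multiples of the curvature densities with the common factor `2 h`. Compression along the struts thus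
carries the weighted curvature of both arcs. -/
theorem strutHeight_mul_strutDensity (hτ : ∀ i, 0 < τ i ∧ τ i ≤ 1) (c : Fin 2 → ℝ)
    (ξ : Fin 2 → C(I, E3)) {p : ℝ} (hp : p ∈ Ioo (0 : ℝ) 1) :
    2 * strutHeight (τ 0 * p) (τ 1 * (1 - p)) * strutDensity τ c ξ p =
      strutRate τ c ξ (τ 0 * p) (τ 1 * (1 - p)) + strutRate τ c ξ (τ 0 * p) (-(τ 1 * (1 - p))) +
        strutRate τ c ξ (-(τ 0 * p)) (τ 1 * (1 - p)) +
        strutRate τ c ξ (-(τ 0 * p)) (-(τ 1 * (1 - p))) := by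
  have h0 := (hτ 0).1
  have h1 := (hτ 1).1
  have hu : 0 < τ 0 * p := mul_pos h0 hp.1
  have hv : 0 < τ 1 * (1 - p) := mul_pos h1 (by linarith [hp.2])
  have hu' : τ 0 * p < τ 0 := mul_lt_of_lt_one_right h0 hp.2
  have hv' : τ 1 * (1 - p) < τ 1 := mul_lt_of_lt_one_right h1 (by linarith [hp.1])
  have hb : τ 0 * p / τ 0 + τ 1 * (1 - p) / τ 1 = 1 := by
    field_simp
    ring
  simp only [strutDensity, bendPairing, strutRate]
  set u := τ 0 * p
  set v := τ 1 * (1 - p)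
  have au : |u| = u := abs_of_pos hu
  have av : |v| = v := abs_of_pos hv
  have b1 : Balanced τ |u| |v| := by rw [au, av]; exact ⟨hu.le, hv.le, hb⟩
  have b2 : Balanced τ |-u| |v| := by rwa [abs_neg]
  have b3 : Balanced τ |u| |-v| := by rwa [abs_neg]
  have s1 := sum_struts_zero hτ b1 (by rwa [au])
  have s2 := sum_struts_zero hτ b2 (by rwa [abs_neg, au])
  have s3 := sum_struts_one hτ b1 (by rwa [av])
  have s4 := sum_struts_one hτ b3 (by rwa [abs_neg, av])
  have eH1 : strutHeight (-u) v = strutHeight u v := by simp [strutHeight]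
  have eH2 : strutHeight u (-v) = strutHeight u v := by simp [strutHeight]
  rw [eH1] at s2
  rw [eH2] at s4
  have pair : ∀ (x A B : E3), inner ℝ A x + inner ℝ B x = inner ℝ x (A + B) := by
    intro x A B
    rw [inner_add_right, real_inner_comm, real_inner_comm x B]
  have t1 := pair (ξ 0 (unitParam τ c 0 u)) _ _ |>.trans (congrArg _ s1)
  have t2 := pair (ξ 0 (unitParam τ c 0 (-u))) _ _ |>.trans (congrArg _ s2)
  have t3 := pair (ξ 1 (unitParam τ c 1 v)) _ _ |>.trans (congrArg _ s3)
  have t4 := pair (ξ 1 (unitParam τ c 1 (-v))) _ _ |>.trans (congrArg _ s4)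
  rw [inner_smul_right] at t1 t2 t3 t4
  rw [inner_sub_right, inner_sub_right, inner_sub_right, inner_sub_right]
  linear_combination t3 + t4 - t1 - t2

theorem strutHeight_pos_of_mem_Ioo (hτ : ∀ i, 0 < τ i ∧ τ i ≤ 1) {p : ℝ}
    (hp : p ∈ Ioo (0 : ℝ) 1) : 0 < strutHeight (τ 0 * p) (τ 1 * (1 - p)) := by
  have h0 := (hτ 0).1
  have h1 := (hτ 1).1
  have hu : 0 < τ 0 * p := mul_pos h0 hp.1
  have hv : 0 < τ 1 * (1 - p) := mul_pos h1 (by linarith [hp.2])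
  have hu' : τ 0 * p < τ 0 := mul_lt_of_lt_one_right h0 hp.2
  have hv' : τ 1 * (1 - p) < τ 1 := mul_lt_of_lt_one_right h1 (by linarith [hp.1])
  have hb : Balanced τ (τ 0 * p) (τ 1 * (1 - p)) := ⟨hu.le, hv.le, by field_simp; ring⟩
  exact Real.sqrt_pos.2 (div_pos (mul_pos (one_sub_sq_pos hτ 0 (by rwa [abs_of_pos hu]))
    (one_sub_sq_pos hτ 1 (by rwa [abs_of_pos hv]))) (hb.denom_pos hτ))

theorem balance_signs (hτ : ∀ i, 0 < τ i ∧ τ i ≤ 1) {p u v : ℝ}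
    (hu : |u| = τ 0 * p) (hv : |v| = τ 1 * (1 - p)) : |u| / τ 0 + |v| / τ 1 = 1 := by
  have h0 := (hτ 0).1.ne'
  have h1 := (hτ 1).1.ne'
  rw [hu, hv]
  field_simp
  ring

theorem stronglyCritical_claspConfig (hτ : ∀ i, 0 < τ i ∧ τ i ≤ 1)
    (hc : ∀ i, bendLevel τ i < c i) :
    StronglyCritical (claspConstraints τ c) (fun i => 1 / τ i) (claspConfig τ c) := by
  have hcont := (isGeneralizedLink_claspConfig hτ hc).continuous
  refine ⟨curvatureForce hτ hc, isCurvatureForce_claspConfig hτ hc, ?_⟩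
  -- The position field lengthens every strut at rate 1, so its density is `2 / h`. Using it as the
  -- comparison density makes the integrability of `1 / h` automatic; it need not be compatible.
  set η : Fin 2 → C(I, E3) := fun i => ⟨claspConfig τ c i, hcont i⟩ with hη
  have hlen : ∀ {u v : ℝ}, |u| / τ 0 + |v| / τ 1 = 1 → strutRate τ c η u v = 1 := by
    intro u v h
    have hb : Balanced τ |u| |v| := ⟨abs_nonneg u, abs_nonneg v, h⟩
    have e0 : η 0 (unitParam τ c 0 u) = arcPoint τ 0 u :=
      claspConfig_unitParam hτ hc ((hb.left_le hτ).trans (lt_halfLength hc 0).le)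
    have e1 : η 1 (unitParam τ c 1 v) = arcPoint τ 1 v :=
      claspConfig_unitParam hτ hc ((hb.right_le hτ).trans (lt_halfLength hc 1).le)
    rw [strutRate, e0, e1, real_inner_self_eq_norm_sq, ← dist_eq_norm,
      dist_arcPoint_eq_one hτ h, one_pow]
  have hsgn : ∀ {p : ℝ}, p ∈ Ioo (0 : ℝ) 1 →
      |τ 0 * p| = τ 0 * p ∧ |τ 1 * (1 - p)| = τ 1 * (1 - p) := fun hp =>
    ⟨abs_of_pos (mul_pos (hτ 0).1 hp.1), abs_of_pos (mul_pos (hτ 1).1 (by linarith [hp.2]))⟩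
  have hηd : ∀ p ∈ Ioo (0 : ℝ) 1,
      2 * strutHeight (τ 0 * p) (τ 1 * (1 - p)) * strutDensity τ c η p = 4 := by
    intro p hp
    obtain ⟨hu, hv⟩ := hsgn hp
    rw [strutHeight_mul_strutDensity hτ c η hp,
      hlen (balance_signs hτ hu hv), hlen (balance_signs hτ hu (by rwa [abs_neg])),
      hlen (balance_signs hτ (by rwa [abs_neg]) hv),
      hlen (balance_signs hτ (by rwa [abs_neg]) (by rwa [abs_neg]))]
    norm_num
  set M : ℝ := ∫ p in (0 : ℝ)..1, strutDensity τ c η p with hM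
  have hMpos : 0 < M := by
    refine intervalIntegral_pos_of_pos_on (intervalIntegrable_strutDensity hτ hc η)
      (fun p hp => ?_) one_pos
    have h1 := strutHeight_pos_of_mem_Ioo hτ hp
    have h2 := hηd p hp
    by_contra hneg
    nlinarith
  refine ⟨1 / M, by positivity, fun ξ hξ hlen1 => ?_⟩
  obtain ⟨dT, hT, hTb⟩ := exists_hasOneSidedVariation_gThi hcont
    (one_le_dist_claspConfig hτ c) (gThi_claspConfig hτ hc) ξ
  obtain ⟨dO, hO⟩ := exists_hasOneSidedVariation_obstacleMin τ c hcont ξ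
  refine ⟨dT, dO, hT, hO, (min_le_left _ _).trans ?_⟩
  have hrate : ∀ {u v : ℝ}, |u| / τ 0 + |v| / τ 1 = 1 → dT ≤ strutRate τ c ξ u v := by
    intro u v h
    have hb : Balanced τ |u| |v| := ⟨abs_nonneg u, abs_nonneg v, h⟩
    have h2 := hTb _ _ (dist_unitParam_eq_one hτ hc h)
    rwa [claspConfig_unitParam hτ hc ((hb.left_le hτ).trans (lt_halfLength hc 0).le),
      claspConfig_unitParam hτ hc ((hb.right_le hτ).trans (lt_halfLength hc 1).le)] at h2
  -- After multiplication by `2 h`, the left side is `4 dT` and the right side the sum of four strut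
  -- rates, each at least `dT`.
  have hle : ∀ p ∈ Ioo (0 : ℝ) 1, dT * strutDensity τ c η p ≤ strutDensity τ c ξ p := by
    intro p hp
    obtain ⟨hu, hv⟩ := hsgn hp
    have h1 := strutHeight_pos_of_mem_Ioo hτ hp
    have h2 := strutHeight_mul_strutDensity hτ c ξ hp
    have r1 := hrate (balance_signs hτ hu hv)
    have r2 := hrate (balance_signs hτ hu (v := -(τ 1 * (1 - p))) (by rwa [abs_neg]))
    have r3 := hrate (balance_signs hτ (u := -(τ 0 * p)) (by rwa [abs_neg]) hv)
    have r4 := hrate (balance_signs hτ (u := -(τ 0 * p)) (v := -(τ 1 * (1 - p)))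
      (by rwa [abs_neg]) (by rwa [abs_neg]))
    refine le_of_mul_le_mul_left ?_ (show 0 < 2 * strutHeight (τ 0 * p) (τ 1 * (1 - p)) by
      positivity)
    calc 2 * strutHeight (τ 0 * p) (τ 1 * (1 - p)) * (dT * strutDensity τ c η p)
        = dT * (2 * strutHeight (τ 0 * p) (τ 1 * (1 - p)) * strutDensity τ c η p) := by ring
      _ = 4 * dT := by rw [hηd p hp]; ring
      _ ≤ _ := by rw [h2]; linarith
  have hint : dT * M ≤ ∫ p in (0 : ℝ)..1, strutDensity τ c ξ p := by
    rw [hM, ← intervalIntegral.integral_const_mul]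
    exact integral_mono_on_of_le_Ioo zero_le_one
      ((intervalIntegrable_strutDensity hτ hc η).const_mul dT)
      (intervalIntegrable_strutDensity hτ hc ξ) hle
  rw [← weighted_variation_eq hτ hc hξ, hlen1] at hint
  rw [← neg_div, le_div_iff₀ hMpos]
  exact hint

end Criticality

end Clasp

end

theorem theorem3p1 (τ c : Fin 2 → ℝ) (hτ : ∀ i, 0 < τ i ∧ τ i ≤ 1)
    (hc : ∀ i, Clasp.bendLevel τ i < c i) :
    Clasp.IsGeneralizedLink (Clasp.claspConstraints τ c) (Clasp.claspConfig τ c) ∧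
    Clasp.InClaspClass τ c (Clasp.claspConfig τ c) ∧
    (∀ u v : ℝ, |u| ≤ τ 0 → |v| ≤ τ 1 → |u| / τ 0 + |v| / τ 1 = 1 →
      dist (Clasp.arcPoint τ 0 u) (Clasp.arcPoint τ 1 v) = 1) ∧
    Clasp.gThi (Clasp.claspConfig τ c) = 1 ∧
    Clasp.StronglyCritical (Clasp.claspConstraints τ c) (fun i => 1 / τ i)
      (Clasp.claspConfig τ c) := by
  exact ⟨Clasp.isGeneralizedLink_claspConfig hτ hc, Clasp.inClaspClass_claspConfig hτ hc,
    fun u v _ _ h => Clasp.dist_arcPoint_eq_one hτ h, Clasp.gThi_claspConfig hτ hc,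
    Clasp.stronglyCritical_claspConfig hτ hc⟩
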